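/- Let $d\ge 1$, let $\Omega\subset\mathbb{R}^d$ be open and bounded with a Lipschitz boundary, and let $\Gamma\subset\Omega$ be a nonempty finite set. Let $R=\min\{|x-y| : x,y\in\Gamma,\ x\ne y\}$ (if $\Gamma$ is a single point, let $R$ be any positive number). Let $r_0>0$ and $\alpha\ge 0$, and let $\gamma\in C^\infty(\overline\Omega\setminus\Gamma)$ satisfy $\gamma\ge 1$ on $\Omega\setminus\Gamma$ and $$\gamma(x)=1+\left(\frac{r_0}{\operatorname{dist}(x,\Gamma)}\right)^{\alpha}\quad\text{for all } x\in\overline\Omega\setminus\Gamma \text{ with } \operatorname{dist}(x,\Gamma)\le \frac R4 .$$ Let $H^1_\gamma(\Omega)$ be the space of all $u\in H^1(\Omega)$ for which $$\|u\|_{H^1_\gamma(\Omega)}^2=\int_\Omega u^2\,dx+\int_\Omega\gamma|\nabla u|^2\,dx$$ is finite, endowed with this norm, and let $H^1_{\gamma,0}(\Omega)$ be the closure of $C_c^\infty(\overline\Omega\setminus\Gamma)$ in $H^1_\gamma(\Omega)$. Assume $\alpha>d-2$. Then for every $u\in H^1_\gamma(\Omega)$ and every $x\in\Gamma$ the limit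 $$\operatorname{Tr}[u](x)=\lim_{\varepsilon\to0^+}\frac1{|B(x,\varepsilon)|}\int_{B(x,\varepsilon)}u\,dy$$ exists in $\mathbb{R}$, so that the trace operator $\operatorname{Tr}:H^1_\gamma(\Omega)\to\mathbb{R}^\Gamma$ is well defined. Moreover, $u\in H^1_{\gamma,0}(\Omega)$ if and only if $u\in H^1_\gamma(\Omega)$ and $\operatorname{Tr}[u]=0$. -/

import Mathlib

open MeasureTheory Filter Topology Set
open scoped ENNReal ContDiff InnerProductSpace

/-- Euclidean space `ℝ^d`. -/
abbrev RSpace (d : ℕ) : Type := EuclideanSpace ℝ (Fin d)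

/-- `Ω` has a Lipschitz boundary: near each boundary point, after a choice of a unit vector `e`,
`Ω` is the open region lying strictly above the graph (in direction `e`) of a Lipschitz function
of the coordinates orthogonal to `e`. -/
def HasLipschitzBoundary {d : ℕ} (Ω : Set (RSpace d)) : Prop :=
  ∀ x₀ ∈ frontier Ω, ∃ e : RSpace d, ‖e‖ = 1 ∧
    ∃ (K : NNReal) (ψ : ((ℝ ∙ e)ᗮ : Submodule ℝ (RSpace d)) → ℝ), LipschitzWith K ψ ∧
      ∃ r : ℝ, 0 < r ∧ ∀ x ∈ Metric.ball x₀ r,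
        (x ∈ Ω ↔ ψ ((ℝ ∙ e)ᗮ.orthogonalProjectionOnto x) < ⟪e, x⟫_ℝ)

/-- `R` is the minimum distance between distinct points of `Γ`. If `Γ` has only one point there is
no such distance, and `R` may be any positive number. -/
def IsMinSeparation {d : ℕ} (Γ : Set (RSpace d)) (R : ℝ) : Prop :=
  0 < R ∧ (Γ.Nontrivial → IsLeast {t : ℝ | ∃ x ∈ Γ, ∃ y ∈ Γ, x ≠ y ∧ t = dist x y} R)

/-- The admissible weights: `γ` is smooth on `closure Ω \ Γ`, `γ ≥ 1` on `Ω` (off the singular set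
`Γ`, where the weight is infinite and the real value of `γ` is irrelevant), and
`γ(x) = 1 + (r₀ / dist(x, Γ))^α` whenever `dist(x, Γ) ≤ R / 4`. -/
structure IsAdmissibleWeight {d : ℕ} (Ω Γ : Set (RSpace d)) (r₀ α R : ℝ)
    (γ : RSpace d → ℝ) : Prop where
  smooth : ContDiffOn ℝ ∞ γ (closure Ω \ Γ)
  one_le : ∀ x ∈ Ω \ Γ, 1 ≤ γ x
  eq_near : ∀ x ∈ closure Ω \ Γ, Metric.infDist x Γ ≤ R / 4 →
    γ x = 1 + (r₀ / Metric.infDist x Γ) ^ α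

/-- `G` is a weak gradient of `u` on `Ω`: both are locally integrable on `Ω` and
`∫_Ω u ∂_v φ = - ∫_Ω (G · v) φ` for all `φ ∈ C_c^∞(Ω)` and all directions `v`. -/
def IsWeakGradient {d : ℕ} (Ω : Set (RSpace d)) (u : RSpace d → ℝ)
    (G : RSpace d → RSpace d) : Prop :=
  LocallyIntegrableOn u Ω ∧ LocallyIntegrableOn G Ω ∧
    ∀ φ : RSpace d → ℝ, ContDiff ℝ ∞ φ → HasCompactSupport φ → tsupport φ ⊆ Ω →
      ∀ v : RSpace d, ∫ x in Ω, u x * fderiv ℝ φ x v = - ∫ x in Ω, ⟪G x, v⟫_ℝ * φ x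

/-- Weak gradients are unique almost everywhere, so that the choice made in `weakGradient` below
does not matter. -/
theorem IsWeakGradient.ae_unique {d : ℕ} {Ω : Set (RSpace d)} (hΩ : IsOpen Ω)
    {u : RSpace d → ℝ} {G H : RSpace d → RSpace d}
    (hG : IsWeakGradient Ω u G) (hH : IsWeakGradient Ω u H) :
    ∀ᵐ x, x ∈ Ω → G x = H x := by
  have key : ∀ i : Fin d, ∀ᵐ x, x ∈ Ω → (G x - H x) i = 0 := by
    intro i
    have hloc : ∀ {F : RSpace d → RSpace d}, LocallyIntegrableOn F Ω →
        LocallyIntegrableOn (fun x => F x i) Ω := by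
      intro F hF x hx
      obtain ⟨s, hs, hint⟩ := hF x hx
      exact ⟨s, hs, (EuclideanSpace.proj (𝕜 := ℝ) i).integrable_comp hint⟩
    have hGi := hloc hG.2.1
    have hHi := hloc hH.2.1
    refine hΩ.ae_eq_zero_of_integral_contDiff_smul_eq_zero (f := fun x => (G x - H x) i)
      (hGi.sub hHi) ?_
    intro φ hφ hc hs
    have hz : ∀ x, x ∉ Ω → φ x = 0 := fun x hx =>
      image_eq_zero_of_notMem_tsupport (fun h => hx (hs h))
    have e1 := hG.2.2 φ hφ hc hs (EuclideanSpace.single i 1)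
    have e2 := hH.2.2 φ hφ hc hs (EuclideanSpace.single i 1)
    have hi : ∀ {F : RSpace d → RSpace d}, LocallyIntegrableOn (fun x => F x i) Ω →
        Integrable (fun x => φ x * F x i) := by
      intro F hF
      have h1 : IntegrableOn (fun x => F x i) (tsupport φ) :=
        hF.integrableOn_compact_subset hs hc
      have h2 : IntegrableOn (fun x => φ x * F x i) (tsupport φ) :=
        h1.continuousOn_mul hφ.continuous.continuousOn hc
      refine (integrableOn_iff_integrable_of_support_subset ?_).1 h2
      intro x hx
      exact subset_tsupport φ (fun h0 => hx (by simp [h0]))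
    have hint : ∀ F : RSpace d → RSpace d,
        ∫ x in Ω, ⟪F x, EuclideanSpace.single i (1 : ℝ)⟫_ℝ * φ x = ∫ x, φ x * F x i := by
      intro F
      rw [setIntegral_eq_integral_of_forall_compl_eq_zero]
      · refine integral_congr_ae (Eventually.of_forall fun x => ?_)
        simp [EuclideanSpace.inner_single_right, mul_comm]
      · intro x hx
        simp [hz x hx]
    rw [hint] at e1 e2
    have : (fun x => φ x • (G x - H x) i) = fun x => φ x * G x i - φ x * H x i := by
      funext x
      simp [mul_sub]
    rw [this, integral_sub (hi hGi) (hi hHi)]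
    linarith
  have hall := ae_all_iff.2 key
  filter_upwards [hall] with x hx hxΩ
  ext i
  have := hx i hxΩ
  simpa [sub_eq_zero] using this

/-- The weak gradient of `u` on `Ω` (zero if there is none). -/
noncomputable def weakGradient {d : ℕ} (Ω : Set (RSpace d)) (u : RSpace d → ℝ) :
    RSpace d → RSpace d :=
  open Classical in
  if h : ∃ G : RSpace d → RSpace d, IsWeakGradient Ω u G then h.choose else 0

/-- The Sobolev space `H^1(Ω)`, its elements represented by functions `ℝ^d → ℝ` of which only the
values almost everywhere on `Ω` matter. -/
def H1 {d : ℕ} (Ω : Set (RSpace d)) : Set (RSpace d → ℝ) :=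
  {u | MemLp u 2 (volume.restrict Ω) ∧
    ∃ G : RSpace d → RSpace d, IsWeakGradient Ω u G ∧ MemLp G 2 (volume.restrict Ω)}

/-- The squared seminorm `[u]² = ∫_Ω γ |∇u|² dx`, as an extended nonnegative number. -/
noncomputable def h1GammaSemiSq {d : ℕ} (Ω : Set (RSpace d)) (γ : RSpace d → ℝ)
    (u : RSpace d → ℝ) : ℝ≥0∞ :=
  ∫⁻ x in Ω, ENNReal.ofReal (γ x) * ‖weakGradient Ω u x‖ₑ ^ 2

/-- The norm `‖u‖ = (‖u‖²_{L²(Ω)} + [u]²)^{1/2}`, as an extended nonnegative number. -/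
noncomputable def h1GammaNorm {d : ℕ} (Ω : Set (RSpace d)) (γ : RSpace d → ℝ)
    (u : RSpace d → ℝ) : ℝ≥0∞ :=
  ((∫⁻ x in Ω, ‖u x‖ₑ ^ 2) + h1GammaSemiSq Ω γ u) ^ (1 / 2 : ℝ)

/-- The weighted space `H^1_γ(Ω)`. -/
def H1Gamma {d : ℕ} (Ω : Set (RSpace d)) (γ : RSpace d → ℝ) : Set (RSpace d → ℝ) :=
  {u | u ∈ H1 Ω ∧ h1GammaNorm Ω γ u < ⊤}

/-- `C_c^∞(closure Ω \ Γ)`: restrictions to `closure Ω` of smooth functions on `ℝ^d` with compact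
support that does not meet `Γ`. (The restriction is implicit: the norm of `H^1_γ(Ω)` sees the
values on `Ω` only.) -/
def testFunctions {d : ℕ} (Γ : Set (RSpace d)) : Set (RSpace d → ℝ) :=
  {φ | ContDiff ℝ ∞ φ ∧ HasCompactSupport φ ∧ Disjoint (tsupport φ) Γ}

/-- `H^1_{γ,0}(Ω)`: the closure of `C_c^∞(closure Ω \ Γ)` in `H^1_γ(Ω)`. -/
def H1GammaZero {d : ℕ} (Ω Γ : Set (RSpace d)) (γ : RSpace d → ℝ) : Set (RSpace d → ℝ) :=
  {u | u ∈ H1Gamma Ω γ ∧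
    ∀ ε : ℝ≥0∞, 0 < ε → ∃ φ ∈ testFunctions Γ, h1GammaNorm Ω γ (fun x => u x - φ x) < ε}

/-- The trace of `u` at `x`: the limit as `ε → 0⁺` of the averages of `u` over `B(x, ε)`. -/
noncomputable def traceAt {d : ℕ} (u : RSpace d → ℝ) (x : RSpace d) : ℝ :=
  limUnder (𝓝[>] (0 : ℝ)) (fun ε : ℝ => ⨍ y in Metric.ball x ε, u y)

/-! Near p ∈ Γ the weight is at least (r₀/|x-p|)^α, so on B(p,s) the unweighted energy is at most
(s/r₀)^α times the weighted energy E(s) of that ball. The Poincaré inequality then bounds the double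
integral of |u(x)-u(y)|² over B(p,s)² by a multiple of s^(2+α) |B(p,s)| E(s). After division by
|B(p,s)|², the mean square oscillation is O(s^(2β)) with 2β = 2+α-d, and β > 0 is exactly the
hypothesis α > d-2. Averages over dyadic balls thus differ by a geometric series, so they converge
to some L, and the integral of |u-L|² over B(p,s) is at most C s^(2+α) E(s) (`exists_trace`).

This estimate gives both directions. On a fixed ball it bounds |L|² by the squared norm of u, so the
trace is continuous; it vanishes on test functions, hence on their closure
(`trace_eq_zero_of_mem_H1GammaZero`). Conversely, if L = 0 it is a Hardy-type inequality. A cutoff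
at scale δ has gradient O(1/δ), living where δ ≤ |x-p| < 2δ and γ ≤ 1+(r₀/δ)^α; the factor δ^(-2-α)
is cancelled by s^(2+α) at s = 2δ, and the energy of the piece cut off is O(E(2δ)), which tends to 0
(`tendsto_h1GammaSq_cutoff`).

What remains vanishes near Γ, where smooth approximation is the classical problem on a Lipschitz
domain with a bounded weight: shift into a cone, mollify, and patch by cutoffs
(`exists_local_smooth_approx`, `isTestLimit_of_eqOn_zero`). The same local approximation carries the
Poincaré inequality from smooth functions to H¹. -/

/-! ### Quadratic integral inequalities, translation and mollification in L² -/

theorem sq_lintegral_mul_le {α : Type*} [MeasurableSpace α] {μ : Measure α} {f g : α → ℝ≥0∞}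
    (hf : AEMeasurable f μ) (hg : AEMeasurable g μ) :
    (∫⁻ x, f x * g x ∂μ) ^ 2 ≤ (∫⁻ x, f x ^ 2 ∂μ) * ∫⁻ x, g x ^ 2 ∂μ := by
  have h := ENNReal.lintegral_mul_le_Lp_mul_Lq μ Real.HolderConjugate.two_two hf hg
  simp only [Pi.mul_apply, ENNReal.rpow_two] at h
  calc (∫⁻ x, f x * g x ∂μ) ^ 2
      ≤ ((∫⁻ x, f x ^ 2 ∂μ) ^ (1 / (2 : ℝ)) * (∫⁻ x, g x ^ 2 ∂μ) ^ (1 / (2 : ℝ))) ^ 2 := by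
        gcongr
    _ = _ := by
        rw [mul_pow, ← ENNReal.rpow_natCast, ← ENNReal.rpow_natCast, ← ENNReal.rpow_mul,
          ← ENNReal.rpow_mul]
        norm_num

theorem sq_lintegral_le {α : Type*} [MeasurableSpace α] {μ : Measure α} {f : α → ℝ≥0∞}
    (hf : AEMeasurable f μ) :
    (∫⁻ x, f x ∂μ) ^ 2 ≤ μ univ * ∫⁻ x, f x ^ 2 ∂μ := by
  have h := sq_lintegral_mul_le (μ := μ) (f := fun _ => 1) (g := f) aemeasurable_const hf
  simpa using h

theorem eLpNorm_two_sq {α F : Type*} [MeasurableSpace α]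
    {μ : Measure α} [NormedAddCommGroup F] (f : α → F) :
    eLpNorm f 2 μ ^ 2 = ∫⁻ x, ‖f x‖ₑ ^ 2 ∂μ := by
  rw [eLpNorm_eq_lintegral_rpow_enorm_toReal (by simp) (by simp), ← ENNReal.rpow_natCast,
    ← ENNReal.rpow_mul]
  simp

theorem enorm_add_sq_le {F : Type*} [SeminormedAddCommGroup F] (a b : F) :
    ‖a + b‖ₑ ^ 2 ≤ 2 * ‖a‖ₑ ^ 2 + 2 * ‖b‖ₑ ^ 2 := by
  have h : (‖a + b‖₊ : ℝ) ^ 2 ≤ 2 * ‖a‖₊ ^ 2 + 2 * ‖b‖₊ ^ 2 := by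
    simp only [coe_nnnorm]
    nlinarith [norm_add_le a b, norm_nonneg (a + b), sq_nonneg (‖a‖ - ‖b‖)]
  simp only [enorm_eq_nnnorm]
  exact_mod_cast h

/-- Translations act continuously on `L²`. -/
theorem exists_lintegral_sub_translate_le {E F : Type*} [NormedAddCommGroup E]
    [NormedSpace ℝ E] [FiniteDimensional ℝ E] [MeasurableSpace E] [BorelSpace E]
    [NormedAddCommGroup F] {μ : Measure E} [μ.IsAddHaarMeasure] {f : E → F} (hf : MemLp f 2 μ)
    {ε : ℝ≥0∞} (hε : 0 < ε) :
    ∃ δ > 0, ∀ z : E, ‖z‖ < δ → ∫⁻ x, ‖f (x - z) - f x‖ₑ ^ 2 ∂μ ≤ ε := by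
  have : Fact ((2 : ℝ≥0∞) ≠ ⊤) := ⟨by simp⟩
  obtain ⟨η, hη, hηε⟩ : ∃ η : ℝ≥0∞, 0 < η ∧ η ^ 2 ≤ ε := by
    refine ⟨min ε 1, by simp [hε], ?_⟩
    calc (min ε 1) ^ 2 = min ε 1 * min ε 1 := sq _
      _ ≤ ε * 1 := by gcongr <;> simp
      _ = ε := mul_one _
  -- Translation is the action of the domain's additive group on L², which is continuous in the
  -- group element; evaluate continuity at z = 0.
  have hc : Continuous fun z : E => (DomAddAct.mk (-z)) +ᵥ (hf.toLp f) := by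
    have h1 : Continuous fun z : E => DomAddAct.mk (-z) :=
      DomAddAct.continuous_mk.comp continuous_neg
    exact h1.vadd continuous_const
  have h0 := (hc.tendsto 0)
  have h2 := (EMetric.tendsto_nhds.1 h0) η hη
  obtain ⟨δ, hδ, hδ'⟩ := Metric.eventually_nhds_iff.1 h2
  refine ⟨δ, hδ, fun z hz => ?_⟩
  have h3 := hδ' (y := z) (by simpa using hz)
  rw [DomAddAct.mk_vadd_toLp, DomAddAct.mk_vadd_toLp, Lp.edist_toLp_toLp] at h3
  have h4 := pow_le_pow_left' h3.le 2
  rw [eLpNorm_two_sq] at h4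
  refine le_trans (le_of_eq ?_) (h4.trans hηε)
  refine lintegral_congr fun x => ?_
  simp [sub_eq_neg_add]

/-- Cauchy–Schwarz for the splitting w f = w^(1/2) · (w^(1/2) f). When w has total mass 1 this is
Jensen's inequality for the square. -/
theorem sq_lintegral_weight_mul_le {α : Type*} [MeasurableSpace α] {μ : Measure α}
    {w f : α → ℝ≥0∞} (hw : AEMeasurable w μ) (hf : AEMeasurable f μ) :
    (∫⁻ x, w x * f x ∂μ) ^ 2 ≤ (∫⁻ x, w x ∂μ) * ∫⁻ x, w x * f x ^ 2 ∂μ := by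
  have hs : ∀ a : ℝ≥0∞, (a ^ (1 / 2 : ℝ)) ^ 2 = a := fun a => by
    rw [← ENNReal.rpow_natCast, ← ENNReal.rpow_mul]; norm_num
  have h := sq_lintegral_mul_le (μ := μ) (f := fun x => w x ^ (1 / 2 : ℝ))
    (g := fun x => w x ^ (1 / 2 : ℝ) * f x) (hw.pow_const _) ((hw.pow_const _).mul hf)
  simpa only [← mul_assoc, ← sq, mul_pow, hs] using h

/-- Averaging translates of an `L²` function with a probability density moves it, in `L²`, by no
more than the translates themselves. -/
theorem lintegral_mollify_sub_le {E F : Type*} [NormedAddCommGroup E]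
    [NormedSpace ℝ E] [FiniteDimensional ℝ E] [MeasurableSpace E] [BorelSpace E]
    [NormedAddCommGroup F] [NormedSpace ℝ F] [CompleteSpace F]
    {μ : Measure E} [μ.IsAddHaarMeasure] {κ : E → ℝ}
    (hκ : Continuous κ) (hκc : HasCompactSupport κ) (hκ0 : ∀ z, 0 ≤ κ z) (hκ1 : ∫ z, κ z ∂μ = 1)
    {f : E → F} (hf : MemLp f 2 μ) {ε : ℝ≥0∞}
    (hε : ∀ z, κ z ≠ 0 → ∫⁻ x, ‖f (x - z) - f x‖ₑ ^ 2 ∂μ ≤ ε) :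
    ∫⁻ x, ‖(∫ t, κ (x - t) • f t ∂μ) - f x‖ₑ ^ 2 ∂μ ≤ ε := by
  -- The Tonelli exchange below needs joint measurability of f (x - z) - f x, so f is replaced by a
  -- strongly measurable representative; no integral sees the change.
  wlog hsm : StronglyMeasurable f generalizing f
  · have hae := hf.1.ae_eq_mk
    have key := this (f := hf.1.mk f) (hf.ae_eq hae) (fun z hz => ?_) hf.1.stronglyMeasurable_mk
    · refine le_trans (le_of_eq ?_) key
      have : ∀ x, ∫ t, κ (x - t) • f t ∂μ = ∫ t, κ (x - t) • hf.1.mk f t ∂μ := fun x =>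
        integral_congr_ae (by filter_upwards [hae] with t ht; rw [ht])
      refine lintegral_congr_ae ?_
      filter_upwards [hae] with x hx
      rw [this, hx]
    · refine le_trans (le_of_eq ?_) (hε z hz)
      refine lintegral_congr_ae ?_
      have h2 := (measurePreserving_sub_right μ z).quasiMeasurePreserving.ae hae
      filter_upwards [hae, h2] with x hx hx2
      rw [hx, hx2]
  have hloc : LocallyIntegrable f μ := hf.locallyIntegrable (by norm_num)
  have hκx : ∀ x, Continuous fun t => κ (x - t) := fun x => by fun_prop
  have hκxc : ∀ x, HasCompactSupport fun t => κ (x - t) := fun x =>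
    hκc.comp_homeomorph (Homeomorph.subLeft x)
  have hκw : ∫⁻ z, ENNReal.ofReal (κ z) ∂μ = 1 := by
    rw [← ofReal_integral_eq_lintegral_ofReal (hκ.integrable_of_hasCompactSupport hκc)
      (Eventually.of_forall hκ0), hκ1, ENNReal.ofReal_one]
  have hκwx : ∀ x, ∫⁻ t, ENNReal.ofReal (κ (x - t)) ∂μ = 1 := fun x => by
    rw [lintegral_sub_left_eq_self (fun z => ENNReal.ofReal (κ z)) x, hκw]
  -- Jensen's inequality for the probability density t ↦ κ (x - t).
  have hpt : ∀ x, ‖(∫ t, κ (x - t) • f t ∂μ) - f x‖ₑ ^ 2 ≤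
      ∫⁻ z, ENNReal.ofReal (κ z) * ‖f (x - z) - f x‖ₑ ^ 2 ∂μ := fun x => by
    have e1 : (∫ t, κ (x - t) • f t ∂μ) - f x = ∫ t, κ (x - t) • (f t - f x) ∂μ := by
      have : ∫ t, κ (x - t) • f x ∂μ = f x := by
        rw [integral_smul_const, integral_sub_left_eq_self κ μ x, hκ1, one_smul]
      simp only [smul_sub]
      rw [integral_sub, this]
      · exact hloc.integrable_smul_left_of_hasCompactSupport (hκx x) (hκxc x)
      · exact ((hκx x).integrable_of_hasCompactSupport (hκxc x)).smul_const _
    rw [e1]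
    calc ‖∫ t, κ (x - t) • (f t - f x) ∂μ‖ₑ ^ 2
        ≤ (∫⁻ t, ENNReal.ofReal (κ (x - t)) * ‖f t - f x‖ₑ ∂μ) ^ 2 := by
          gcongr
          refine (enorm_integral_le_lintegral_enorm _).trans (le_of_eq ?_)
          refine lintegral_congr fun t => ?_
          rw [enorm_smul, Real.enorm_of_nonneg (hκ0 _)]
      _ ≤ 1 * ∫⁻ t, ENNReal.ofReal (κ (x - t)) * ‖f t - f x‖ₑ ^ 2 ∂μ := by
          rw [← hκwx x]
          exact sq_lintegral_weight_mul_le (hκx x).measurable.ennreal_ofReal.aemeasurable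
            (hsm.sub stronglyMeasurable_const).enorm.aemeasurable
      _ = _ := by
          rw [one_mul, ← lintegral_sub_left_eq_self _ x]
          simp
  calc ∫⁻ x, ‖(∫ t, κ (x - t) • f t ∂μ) - f x‖ₑ ^ 2 ∂μ
      ≤ ∫⁻ x, ∫⁻ z, ENNReal.ofReal (κ z) * ‖f (x - z) - f x‖ₑ ^ 2 ∂μ ∂μ := lintegral_mono hpt
    _ = ∫⁻ z, ∫⁻ x, ENNReal.ofReal (κ z) * ‖f (x - z) - f x‖ₑ ^ 2 ∂μ ∂μ := by
        refine lintegral_lintegral_swap (Measurable.aemeasurable ?_)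
        have h1 : Measurable fun p : E × E => ENNReal.ofReal (κ p.2) :=
          (hκ.measurable.comp measurable_snd).ennreal_ofReal
        have h2 : StronglyMeasurable fun p : E × E => f (p.1 - p.2) - f p.1 :=
          (hsm.comp_measurable (measurable_fst.sub measurable_snd)).sub
            (hsm.comp_measurable measurable_fst)
        exact h1.mul (h2.enorm.pow_const 2)
    _ ≤ ∫⁻ z, ENNReal.ofReal (κ z) * ε ∂μ := by
        refine lintegral_mono fun z => ?_
        simp only
        rw [lintegral_const_mul' _ _ ENNReal.ofReal_ne_top]
        by_cases hz : κ z = 0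
        · simp [hz]
        · gcongr
          exact hε z hz
    _ = ε := by
        rw [lintegral_mul_const _ hκ.measurable.ennreal_ofReal, hκw, one_mul]

/-! ### Calculus of weak gradients -/

theorem ContDiff.continuous_gradient {d : ℕ} {φ : RSpace d → ℝ} (hφ : ContDiff ℝ ∞ φ) :
    Continuous (gradient φ) :=
  (InnerProductSpace.toDual ℝ (RSpace d)).symm.continuous.comp (hφ.continuous_fderiv (by simp))

theorem LocallyIntegrableOn.integrableOn_mul_of_tsupport_subset {d : ℕ} {Ω : Set (RSpace d)}
    {u ψ : RSpace d → ℝ} (hu : LocallyIntegrableOn u Ω) (hψ : Continuous ψ)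
    (hc : HasCompactSupport ψ) (hs : tsupport ψ ⊆ Ω) :
    IntegrableOn (fun x => u x * ψ x) Ω := by
  have h1 : IntegrableOn u (tsupport ψ) := hu.integrableOn_compact_subset hs hc
  have h2 : IntegrableOn (fun x => u x * ψ x) (tsupport ψ) :=
    h1.mul_continuousOn hψ.continuousOn hc
  refine ((integrableOn_iff_integrable_of_support_subset ?_).1 h2).integrableOn
  intro x hx
  exact subset_tsupport ψ (fun h0 => hx (by simp [h0]))

theorem LocallyIntegrableOn.inner_const {d : ℕ} {Ω : Set (RSpace d)}
    {G : RSpace d → RSpace d} (hG : LocallyIntegrableOn G Ω) (v : RSpace d) :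
    LocallyIntegrableOn (fun x => ⟪G x, v⟫_ℝ) Ω := by
  intro x hx
  obtain ⟨s, hs, hint⟩ := hG x hx
  exact ⟨s, hs, Integrable.inner_const (𝕜 := ℝ) hint v⟩

theorem tsupport_fderiv_apply_subset' {d : ℕ} {φ : RSpace d → ℝ} (v : RSpace d) :
    tsupport (fun x => fderiv ℝ φ x v) ⊆ tsupport φ :=
  tsupport_fderiv_apply_subset ℝ v

namespace IsWeakGradient

variable {d : ℕ} {Ω : Set (RSpace d)} {u w : RSpace d → ℝ} {G H : RSpace d → RSpace d}

theorem add (hu : IsWeakGradient Ω u G) (hw : IsWeakGradient Ω w H) :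
    IsWeakGradient Ω (fun x => u x + w x) (fun x => G x + H x) := by
  refine ⟨hu.1.add hw.1, hu.2.1.add hw.2.1, fun φ hφ hc hs v => ?_⟩
  have hφ' : Continuous fun x => fderiv ℝ φ x v :=
    (hφ.continuous_fderiv (by simp)).clm_apply continuous_const
  have hc' : HasCompactSupport fun x => fderiv ℝ φ x v := hc.fderiv_apply ℝ v
  have hs' := (tsupport_fderiv_apply_subset' (φ := φ) v).trans hs
  simp only [add_mul, inner_add_left]
  rw [integral_add (LocallyIntegrableOn.integrableOn_mul_of_tsupport_subset hu.1 hφ' hc' hs')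
    (LocallyIntegrableOn.integrableOn_mul_of_tsupport_subset hw.1 hφ' hc' hs'),
    integral_add (LocallyIntegrableOn.integrableOn_mul_of_tsupport_subset
      (LocallyIntegrableOn.inner_const hu.2.1 v) hφ.continuous hc hs)
    (LocallyIntegrableOn.integrableOn_mul_of_tsupport_subset
      (LocallyIntegrableOn.inner_const hw.2.1 v) hφ.continuous hc hs),
    hu.2.2 φ hφ hc hs v, hw.2.2 φ hφ hc hs v, neg_add]

/-- The product rule for weak gradients and smooth factors. -/
theorem smooth_mul (hΩ : IsOpen Ω) (hu : IsWeakGradient Ω u G) {b : RSpace d → ℝ}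
    (hb : ContDiff ℝ ∞ b) :
    IsWeakGradient Ω (fun x => b x * u x) (fun x => b x • G x + u x • gradient b x) := by
  refine ⟨hu.1.continuousOn_mul hb.continuous.continuousOn hΩ.isLocallyClosed,
    (hu.2.1.continuousOn_smul hΩ.isLocallyClosed hb.continuous.continuousOn).add
      (hu.1.smul_continuousOn hΩ.isLocallyClosed hb.continuous_gradient.continuousOn),
    fun φ hφ hc hs v => ?_⟩
  -- The weak equation for u is tested with b φ; the Leibniz rule for b φ then produces the extra
  -- term with the gradient of b.
  have hbφ : ContDiff ℝ ∞ fun x => b x * φ x := hb.mul hφ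
  have hbc : HasCompactSupport fun x => b x * φ x := hc.mul_left
  have hbs : tsupport (fun x => b x * φ x) ⊆ Ω := (tsupport_mul_subset_right).trans hs
  have h := hu.2.2 _ hbφ hbc hbs v
  have hb' : Continuous fun x => fderiv ℝ b x v :=
    (hb.continuous_fderiv (by simp)).clm_apply continuous_const
  have hφ' : Continuous fun x => fderiv ℝ φ x v :=
    (hφ.continuous_fderiv (by simp)).clm_apply continuous_const
  have i1 : IntegrableOn (fun x => u x * (b x * fderiv ℝ φ x v)) Ω :=
    LocallyIntegrableOn.integrableOn_mul_of_tsupport_subset hu.1 (hb.continuous.mul hφ')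
      (hc.fderiv_apply ℝ v).mul_left
      ((tsupport_mul_subset_right).trans ((tsupport_fderiv_apply_subset' v).trans hs))
  have i2 : IntegrableOn (fun x => u x * (fderiv ℝ b x v * φ x)) Ω :=
    LocallyIntegrableOn.integrableOn_mul_of_tsupport_subset hu.1 (hb'.mul hφ.continuous)
      hc.mul_left ((tsupport_mul_subset_right).trans hs)
  have i3 : IntegrableOn (fun x => ⟪G x, v⟫_ℝ * (b x * φ x)) Ω :=
    LocallyIntegrableOn.integrableOn_mul_of_tsupport_subset
      (LocallyIntegrableOn.inner_const hu.2.1 v) hbφ.continuous hbc hbs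
  have e1 : ∀ x, u x * fderiv ℝ (fun x => b x * φ x) x v =
      u x * (b x * fderiv ℝ φ x v) + u x * (fderiv ℝ b x v * φ x) := fun x => by
    rw [fderiv_fun_mul (hb.differentiable (by simp)).differentiableAt
      (hφ.differentiable (by simp)).differentiableAt]
    simp
    ring
  simp only [e1] at h
  rw [integral_add i1 i2] at h
  have e2 : ∀ x, ⟪b x • G x + u x • gradient b x, v⟫_ℝ * φ x =
      ⟪G x, v⟫_ℝ * (b x * φ x) + u x * (fderiv ℝ b x v * φ x) := fun x => by
    rw [inner_add_left, inner_smul_left, inner_smul_left, inner_gradient_left]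
    simp
    ring
  simp only [e2]
  rw [integral_add i3 i2]
  have e3 : ∀ x, b x * u x * fderiv ℝ φ x v = u x * (b x * fderiv ℝ φ x v) := fun x => by ring
  simp only [e3]
  linarith

/-- The test function is supported in Ω, so this is integration by parts on the whole space and no
boundary term can arise. -/
theorem of_contDiff {φ : RSpace d → ℝ} (hφ : ContDiff ℝ ∞ φ) :
    IsWeakGradient Ω φ (gradient φ) := by
  refine ⟨hφ.continuous.locallyIntegrable.locallyIntegrableOn _,
    hφ.continuous_gradient.locallyIntegrable.locallyIntegrableOn _, fun ψ hψ hc hs v => ?_⟩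
  have hφ' : Continuous fun x => fderiv ℝ φ x v :=
    (hφ.continuous_fderiv (by simp)).clm_apply continuous_const
  have hψ' : Continuous fun x => fderiv ℝ ψ x v :=
    (hψ.continuous_fderiv (by simp)).clm_apply continuous_const
  have hz : ∀ x, x ∉ Ω → ψ x = 0 := fun x hx =>
    image_eq_zero_of_notMem_tsupport fun h => hx (hs h)
  have hz' : ∀ x, x ∉ Ω → fderiv ℝ ψ x v = 0 := fun x hx =>
    image_eq_zero_of_notMem_tsupport (f := fun x => fderiv ℝ ψ x v)
      fun h => hx (hs (tsupport_fderiv_apply_subset' v h))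
  rw [setIntegral_eq_integral_of_forall_compl_eq_zero (fun x hx => by simp [hz' x hx]),
    setIntegral_eq_integral_of_forall_compl_eq_zero (fun x hx => by simp [hz x hx])]
  simp only [inner_gradient_left]
  refine integral_mul_fderiv_eq_neg_fderiv_mul_of_integrable ?_ ?_ ?_ ?_ ?_
  · exact (hφ'.mul hψ.continuous).integrable_of_hasCompactSupport hc.mul_left
  · exact (hφ.continuous.mul hψ').integrable_of_hasCompactSupport (hc.fderiv_apply ℝ v).mul_left
  · exact (hφ.continuous.mul hψ.continuous).integrable_of_hasCompactSupport hc.mul_left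
  · exact fun x _ => (hφ.differentiable (by simp)).differentiableAt
  · exact fun x _ => (hψ.differentiable (by simp)).differentiableAt

theorem neg (hu : IsWeakGradient Ω u G) :
    IsWeakGradient Ω (fun x => - u x) (fun x => - G x) := by
  refine ⟨hu.1.neg, hu.2.1.neg, fun φ hφ hc hs v => ?_⟩
  have := hu.2.2 φ hφ hc hs v
  simp only [inner_neg_left, neg_mul, integral_neg, this]

theorem sub (hu : IsWeakGradient Ω u G) (hw : IsWeakGradient Ω w H) :
    IsWeakGradient Ω (fun x => u x - w x) (fun x => G x - H x) := by
  simpa only [sub_eq_add_neg] using hu.add hw.neg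

theorem isWeakGradient_weakGradient (hu : IsWeakGradient Ω u G) :
    IsWeakGradient Ω u (weakGradient Ω u) := by
  have h : ∃ G : RSpace d → RSpace d, IsWeakGradient Ω u G := ⟨G, hu⟩
  rw [weakGradient, dif_pos h]
  exact h.choose_spec

theorem weakGradient_ae_eq (hΩ : IsOpen Ω) (hu : IsWeakGradient Ω u G) :
    weakGradient Ω u =ᵐ[volume.restrict Ω] G :=
  (ae_restrict_iff' hΩ.measurableSet).2 (ae_unique hΩ hu.isWeakGradient_weakGradient hu)

/-- Inside the domain, the gradient of a mollification is the mollification of the weak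
gradient. -/
theorem gradient_mollify (hΩ : IsOpen Ω) (hu : IsWeakGradient Ω u G)
    (hu2 : MemLp u 2 (volume.restrict Ω)) (hG2 : MemLp G 2 (volume.restrict Ω))
    {κ : RSpace d → ℝ} (hκ : ContDiff ℝ ∞ κ) (hκc : HasCompactSupport κ) {x : RSpace d}
    (hx : tsupport (fun t => κ (x - t)) ⊆ Ω) :
    gradient (convolution (Ω.indicator u) κ (ContinuousLinearMap.mul ℝ ℝ) volume) x =
      ∫ t, κ (x - t) • Ω.indicator G t := by
  have hul : LocallyIntegrable (Ω.indicator u) :=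
    ((memLp_indicator_iff_restrict hΩ.measurableSet).2 hu2).locallyIntegrable (by norm_num)
  have hGl : LocallyIntegrable (Ω.indicator G) :=
    ((memLp_indicator_iff_restrict hΩ.measurableSet).2 hG2).locallyIntegrable (by norm_num)
  have hκx : ContDiff ℝ ∞ fun t => κ (x - t) := hκ.comp (contDiff_const.sub contDiff_id)
  have hκxc : HasCompactSupport fun t => κ (x - t) := hκc.comp_homeomorph (Homeomorph.subLeft x)
  refine ext_inner_right ℝ fun v => ?_
  rw [inner_gradient_left, (hκc.hasFDerivAt_convolution_right _ hul
    (hκ.of_le (by simp)) x).fderiv, convolution_precompR_apply _ hul (hκc.fderiv ℝ)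
    (hκ.continuous_fderiv (by simp))]
  -- The reflected kernel t ↦ κ (x - t) is an admissible test function by `hx`; its reflection
  -- supplies the sign that cancels the minus of the weak equation.
  have h := hu.2.2 _ hκx hκxc hx v
  have hd : ∀ t, fderiv ℝ (fun t => κ (x - t)) t v = - fderiv ℝ κ (x - t) v := fun t => by
    have h1 : HasFDerivAt κ (fderiv ℝ κ (x - t)) (x - t) :=
      (hκ.differentiable (by simp)).differentiableAt.hasFDerivAt
    have h2 : HasFDerivAt (fun t => κ (x - t)) _ t := h1.comp t ((hasFDerivAt_id t).const_sub x)
    rw [h2.fderiv]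
    simp
  simp only [hd, mul_neg, integral_neg, neg_inj] at h
  have hint : Integrable fun t => κ (x - t) • Ω.indicator G t :=
    hGl.integrable_smul_left_of_hasCompactSupport hκx.continuous hκxc
  rw [convolution_def, real_inner_comm, ← integral_inner hint]
  simp only [ContinuousLinearMap.mul_apply', inner_smul_right]
  rw [← setIntegral_eq_integral_of_forall_compl_eq_zero (s := Ω)
    (fun t ht => by simp [indicator_of_notMem ht]),
    ← setIntegral_eq_integral_of_forall_compl_eq_zero (s := Ω)
    (f := fun t => κ (x - t) * _) (fun t ht => by simp [indicator_of_notMem ht])]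
  refine (setIntegral_congr_fun hΩ.measurableSet fun t ht => ?_).trans
    (h.trans (setIntegral_congr_fun hΩ.measurableSet fun t ht => ?_))
  · simp [indicator_of_mem ht]
  · simp [indicator_of_mem ht, mul_comm, real_inner_comm]

end IsWeakGradient

/-! ### Smooth approximation up to a Lipschitz boundary -/

/-- A Lipschitz domain has a uniform cone property near each point of its closure. -/
theorem exists_local_cone {d : ℕ} {Ω : Set (RSpace d)} (hΩ : IsOpen Ω)
    (hlip : HasLipschitzBoundary Ω) {x₀ : RSpace d} (hx₀ : x₀ ∈ closure Ω) :
    ∃ r > 0, ∃ e : RSpace d, ∃ c > 0, ∃ t₀ > 0, ∀ t : ℝ, 0 < t → t < t₀ →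
      ∀ x ∈ Ω ∩ Metric.ball x₀ r, ∀ z ∈ Metric.closedBall e c, x + t • z ∈ Ω := by
  by_cases hx : x₀ ∈ Ω
  · obtain ⟨r, hr, hrΩ⟩ := Metric.isOpen_iff.1 hΩ x₀ hx
    -- At an interior point every direction is admissible, so the cone is a ball about 0.
    refine ⟨r / 2, by positivity, 0, 1, one_pos, r / 2, by positivity, ?_⟩
    intro t ht ht0 x hxx z hz
    apply hrΩ
    have h1 : ‖x - x₀‖ < r / 2 := by simpa [dist_eq_norm] using hxx.2
    have h2 : ‖z‖ ≤ 1 := by simpa using hz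
    rw [Metric.mem_ball, dist_eq_norm]
    calc ‖x + t • z - x₀‖ = ‖(x - x₀) + t • z‖ := by congr 1; abel
      _ ≤ ‖x - x₀‖ + t * ‖z‖ := by
          refine (norm_add_le _ _).trans ?_
          rw [norm_smul, Real.norm_of_nonneg ht.le]
      _ < r := by nlinarith
  · have hfr : x₀ ∈ frontier Ω := ⟨hx₀, by rwa [hΩ.interior_eq]⟩
    obtain ⟨e, he, K, ψ, hψ, r, hr, hΩr⟩ := hlip x₀ hfr
    have hK : (0 : ℝ) ≤ K := K.2
    refine ⟨r / 2, by positivity, e, 1 / (K + 2), by positivity, r / 4, by positivity, ?_⟩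
    intro t ht ht0 x hxx z hz
    -- Along t • z with z within c of e, the height grows by at least t(1 - c) and the graph by at
    -- most t K c. The choice of c makes 1 - c - K c = c > 0.
    set c : ℝ := 1 / (K + 2) with hc
    have hc0 : 0 < c := by positivity
    have hcK : K * c + 2 * c = 1 := by rw [hc]; field_simp
    have h1 : ‖x - x₀‖ < r / 2 := by simpa [dist_eq_norm] using hxx.2
    have h2 : ‖z - e‖ ≤ c := by simpa [dist_eq_norm] using hz
    have h3 : ‖z‖ ≤ 2 := by
      have : ‖z‖ ≤ ‖z - e‖ + ‖e‖ := by simpa using norm_add_le (z - e) e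
      nlinarith [mul_nonneg hK hc0.le]
    have hxb : x ∈ Metric.ball x₀ r := by
      rw [Metric.mem_ball, dist_eq_norm]; linarith
    have hyb : x + t • z ∈ Metric.ball x₀ r := by
      rw [Metric.mem_ball, dist_eq_norm]
      calc ‖x + t • z - x₀‖ = ‖(x - x₀) + t • z‖ := by congr 1; abel
        _ ≤ ‖x - x₀‖ + t * ‖z‖ := by
            refine (norm_add_le _ _).trans ?_
            rw [norm_smul, Real.norm_of_nonneg ht.le]
        _ < r := by nlinarith
    rw [hΩr _ hyb]
    have hxψ := (hΩr _ hxb).1 hxx.1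
    set P := (ℝ ∙ e)ᗮ.orthogonalProjectionOnto with hP
    have hPe : P e = 0 := by
      rw [hP, Submodule.orthogonalProjectionOnto_eq_zero_iff, Submodule.orthogonal_orthogonal]
      exact Submodule.mem_span_singleton_self e
    have hPz : ‖P z‖ ≤ c := by
      have : P z = P (z - e) := by rw [map_sub, hPe, sub_zero]
      rw [this]
      exact (Submodule.norm_orthogonalProjectionOnto_apply_le _ _).trans h2
    have hψ1 : ψ (P (x + t • z)) ≤ ψ (P x) + K * (t * c) := by
      have h := hψ.dist_le_mul (P (x + t • z)) (P x)
      rw [Real.dist_eq, dist_eq_norm] at h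
      have e1 : P (x + t • z) - P x = t • P z := by
        rw [map_add, map_smul]; abel
      rw [e1, norm_smul, Real.norm_of_nonneg ht.le] at h
      have h' : (K : ℝ) * (t * ‖P z‖) ≤ K * (t * c) := by gcongr
      linarith [le_abs_self (ψ (P (x + t • z)) - ψ (P x))]
    have hin : ⟪e, x + t • z⟫_ℝ ≥ ⟪e, x⟫_ℝ + t * (1 - c) := by
      have e1 : ⟪e, z⟫_ℝ = 1 + ⟪e, z - e⟫_ℝ := by
        rw [inner_sub_right, real_inner_self_eq_norm_sq, he]; ring
      have e2 : |⟪e, z - e⟫_ℝ| ≤ c := by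
        refine (abs_real_inner_le_norm _ _).trans ?_
        rw [he, one_mul]; exact h2
      rw [inner_add_right, inner_smul_right, e1]
      have := neg_le_of_abs_le e2
      nlinarith
    nlinarith

/-- The free centre `a` makes one kernel both shift and smooth, so that near the boundary only
values inside the domain are sampled. -/
theorem exists_mollifier {d : ℕ} (a : RSpace d) {ρ : ℝ} (hρ : 0 < ρ) :
    ∃ κ : RSpace d → ℝ, ContDiff ℝ ∞ κ ∧ HasCompactSupport κ ∧ (∀ z, 0 ≤ κ z) ∧
      ∫ z, κ z = 1 ∧ ∀ z, κ z ≠ 0 → ‖z - a‖ < ρ := by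
  let B : ContDiffBump a := ⟨ρ / 2, ρ, by positivity, by linarith⟩
  refine ⟨B.normed volume, B.contDiff_normed, B.hasCompactSupport_normed, B.nonneg_normed,
    B.integral_normed, fun z hz => ?_⟩
  have h : z ∈ Function.support (B.normed volume) := hz
  rwa [B.support_normed_eq, Metric.mem_ball, dist_eq_norm] at h

/-- Near each point of the closure of a Lipschitz domain, functions in `H¹` are limits of functions
which are smooth on the whole space. -/
theorem exists_local_smooth_approx {d : ℕ} {Ω : Set (RSpace d)} (hΩ : IsOpen Ω)
    (hlip : HasLipschitzBoundary Ω) {x₀ : RSpace d} (hx₀ : x₀ ∈ closure Ω) :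
    ∃ r > 0, ∀ (u : RSpace d → ℝ) (G : RSpace d → RSpace d), IsWeakGradient Ω u G →
      MemLp u 2 (volume.restrict Ω) → MemLp G 2 (volume.restrict Ω) → ∀ ε : ℝ≥0∞, 0 < ε →
      ∃ v : RSpace d → ℝ, ContDiff ℝ ∞ v ∧ ∫⁻ x in Ω, ‖v x - u x‖ₑ ^ 2 ≤ ε ∧
        ∫⁻ x in Ω ∩ Metric.ball x₀ r, ‖gradient v x - G x‖ₑ ^ 2 ≤ ε := by
  obtain ⟨r, hr, e, c, hc, t₀, ht₀, hcone⟩ := exists_local_cone hΩ hlip hx₀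
  refine ⟨r, hr, fun u G hu hu2 hG2 ε hε => ?_⟩
  have hu2' := (memLp_indicator_iff_restrict hΩ.measurableSet).2 hu2
  have hG2' := (memLp_indicator_iff_restrict hΩ.measurableSet).2 hG2
  obtain ⟨δ₁, hδ₁, h₁⟩ := exists_lintegral_sub_translate_le hu2' hε
  obtain ⟨δ₂, hδ₂, h₂⟩ := exists_lintegral_sub_translate_le hG2' hε
  obtain ⟨t, ht, htt₀, htδ⟩ : ∃ t > 0, t < t₀ ∧ t * (‖e‖ + c) < min δ₁ δ₂ := by
    have hm : 0 < min δ₁ δ₂ := lt_min hδ₁ hδ₂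
    have hec : 0 < ‖e‖ + c := by positivity
    refine ⟨min (t₀ / 2) (min δ₁ δ₂ / (2 * (‖e‖ + c))), by positivity, ?_, ?_⟩
    · exact (min_le_left _ _).trans_lt (by linarith)
    · calc min (t₀ / 2) (min δ₁ δ₂ / (2 * (‖e‖ + c))) * (‖e‖ + c)
          ≤ min δ₁ δ₂ / (2 * (‖e‖ + c)) * (‖e‖ + c) := by gcongr; exact min_le_right _ _
        _ = min δ₁ δ₂ / 2 := by field_simp
        _ < _ := by linarith
  -- If x - s lies in the ball of radius t c about -t e, then s lies in x + t • closedBall e c,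
  -- which the cone property places in Ω. The choice of t keeps these displacements below both
  -- translation moduli.
  obtain ⟨κ, hκs, hκc, hκ0, hκ1, hκsupp⟩ := exists_mollifier (-(t • e)) (mul_pos ht hc)
  have hκz : ∀ z, κ z ≠ 0 → ‖z‖ < min δ₁ δ₂ := fun z hz => by
    have h := hκsupp z hz
    rw [sub_neg_eq_add] at h
    have h' : ‖z‖ ≤ ‖z + t • e‖ + ‖t • e‖ := by simpa using norm_sub_le (z + t • e) (t • e)
    rw [norm_smul, Real.norm_of_nonneg ht.le] at h'
    nlinarith
  have hsupp : ∀ x ∈ Ω ∩ Metric.ball x₀ r, tsupport (fun s => κ (x - s)) ⊆ Ω := by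
    intro x hx s hs
    have hs' : x - s ∈ Metric.closedBall (-(t • e)) (t * c) := by
      have hsub : tsupport (fun s => κ (x - s)) ⊆
          (fun s => x - s) ⁻¹' Metric.closedBall (-(t • e)) (t * c) := by
        refine closure_minimal (fun y hy => ?_)
          (Metric.isClosed_closedBall.preimage (by fun_prop))
        rw [mem_preimage, Metric.mem_closedBall, dist_eq_norm]
        exact (hκsupp _ hy).le
      exact hsub hs
    have h := hcone t ht htt₀ x hx (t⁻¹ • (s - x)) ?_
    · rwa [smul_smul, mul_inv_cancel₀ ht.ne', one_smul, add_sub_cancel] at h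
    · rw [Metric.mem_closedBall, dist_eq_norm] at hs' ⊢
      have e1 : t⁻¹ • (s - x) - e = -(t⁻¹ • (x - s - -(t • e))) := by
        rw [sub_neg_eq_add, smul_add, smul_smul, inv_mul_cancel₀ ht.ne', one_smul, smul_sub,
          smul_sub]
        abel
      rw [e1, norm_neg, norm_smul, norm_inv, Real.norm_of_nonneg ht.le, inv_mul_le_iff₀ ht]
      exact hs'
  refine ⟨convolution (Ω.indicator u) κ (ContinuousLinearMap.mul ℝ ℝ) volume,
    hκc.contDiff_convolution_right _ (hu2'.locallyIntegrable (by norm_num)) hκs, ?_, ?_⟩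
  · have h := lintegral_mollify_sub_le hκs.continuous hκc hκ0 hκ1 hu2'
      (fun z hz => h₁ z ((hκz z hz).trans_le (min_le_left _ _)))
    refine (le_of_eq ?_).trans ((setLIntegral_le_lintegral Ω _).trans h)
    refine setLIntegral_congr_fun hΩ.measurableSet fun x hx => ?_
    simp only [convolution_def, ContinuousLinearMap.mul_apply', smul_eq_mul,
      indicator_of_mem hx]
    simp only [mul_comm]
  · have h := lintegral_mollify_sub_le hκs.continuous hκc hκ0 hκ1 hG2'
      (fun z hz => h₂ z ((hκz z hz).trans_le (min_le_right _ _)))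
    refine (le_of_eq ?_).trans ((setLIntegral_le_lintegral (Ω ∩ Metric.ball x₀ r) _).trans h)
    refine setLIntegral_congr_fun (hΩ.measurableSet.inter measurableSet_ball) fun x hx => ?_
    simp only [hu.gradient_mollify hΩ hu2 hG2 hκs hκc (hsupp x hx), indicator_of_mem hx.1]

/-! ### A Poincaré inequality on convex sets -/

theorem ENNReal.le_of_forall_le_add_mul {a b A : ℝ≥0∞} (hA : A ≠ ⊤)
    (h : ∀ ε : ℝ≥0∞, 0 < ε → a ≤ b + ε * A) : a ≤ b := by
  by_cases hA0 : A = 0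
  · simpa [hA0] using h 1 one_pos
  · refine ENNReal.le_of_forall_pos_le_add fun ε hε _ => ?_
    have h1 := h (ε / A) (ENNReal.div_pos (by simpa using hε.ne') hA)
    rwa [ENNReal.div_mul_cancel hA0 hA] at h1

theorem lintegral_comp_add_smul {d : ℕ} {f : RSpace d → ℝ≥0∞} (hf : Measurable f)
    (a : RSpace d) {t : ℝ} (ht : 0 < t) :
    ∫⁻ y, f (a + t • y) = ENNReal.ofReal (t ^ d)⁻¹ * ∫⁻ y, f y := by
  have h1 : Measurable fun y => f (a + y) := hf.comp (measurable_const_add a)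
  have h2 := lintegral_map h1 (measurable_const_smul (α := RSpace d) t) (μ := volume)
  rw [← h2]
  change ∫⁻ y, f (a + y) ∂(Measure.map (fun x : RSpace d => t • x) volume) = _
  rw [Measure.map_addHaar_smul volume ht.ne', lintegral_smul_measure,
    lintegral_add_left_eq_self, finrank_euclideanSpace_fin, abs_of_pos (by positivity),
    smul_eq_mul]

/-- The Jacobian factor t^(-d) is at most 2^d because t stays above 1/2. -/
theorem setLIntegral_comp_add_smul_le {d : ℕ} {f : RSpace d → ℝ≥0∞} (hf : Measurable f)
    {S : Set (RSpace d)} (hS : MeasurableSet S) (a : RSpace d) {t : ℝ} (ht : 1 / 2 ≤ t)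
    (hmaps : ∀ y ∈ S, a + t • y ∈ S) :
    ∫⁻ y in S, f (a + t • y) ≤ 2 ^ d * ∫⁻ y in S, f y := by
  have ht0 : 0 < t := by linarith
  calc ∫⁻ y in S, f (a + t • y) = ∫⁻ y in S, S.indicator f (a + t • y) :=
        setLIntegral_congr_fun hS fun y hy => by
          simp only [indicator_of_mem (hmaps y hy)]
    _ ≤ ∫⁻ y, S.indicator f (a + t • y) := setLIntegral_le_lintegral _ _
    _ = ENNReal.ofReal (t ^ d)⁻¹ * ∫⁻ y in S, f y := by
        rw [lintegral_comp_add_smul (hf.indicator hS) a ht0, lintegral_indicator hS]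
    _ ≤ _ := by
        gcongr
        have h2 : (2 : ℝ≥0∞) ^ d = ENNReal.ofReal (2 ^ d) := by
          rw [ENNReal.ofReal_pow (by norm_num)]; simp
        rw [h2]
        refine ENNReal.ofReal_le_ofReal ?_
        rw [← inv_pow]
        gcongr
        rw [inv_le_comm₀ ht0 (by norm_num)]
        simpa using ht

/-- The fundamental theorem of calculus along the segment, then Cauchy–Schwarz on the unit interval.
-/
theorem ContDiff.enorm_sub_sq_le {d : ℕ} {v : RSpace d → ℝ} (hv : ContDiff ℝ ∞ v)
    (x y : RSpace d) :
    ‖v x - v y‖ₑ ^ 2 ≤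
      ‖x - y‖ₑ ^ 2 * ∫⁻ t in Ioo (0 : ℝ) 1, ‖gradient v ((1 - t) • x + t • y)‖ₑ ^ 2 := by
  have hline : ∀ t : ℝ, HasDerivAt (fun t : ℝ => (1 - t) • x + t • y) (y - x) t := fun t => by
    have h1 : HasDerivAt (fun t : ℝ => (1 - t) • x) ((-1 : ℝ) • x) t :=
      ((hasDerivAt_id t).const_sub 1).smul_const x
    have h2 : HasDerivAt (fun t : ℝ => t • y) ((1 : ℝ) • y) t := (hasDerivAt_id t).smul_const y
    convert! h1.add h2 using 1
    simp [sub_eq_neg_add]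
  have hder : ∀ t : ℝ, HasDerivAt (fun t : ℝ => v ((1 - t) • x + t • y))
      (fderiv ℝ v ((1 - t) • x + t • y) (y - x)) t := fun t =>
    ((hv.differentiable (by simp)).differentiableAt.hasFDerivAt).comp_hasDerivAt t (hline t)
  have hcl : Continuous fun t : ℝ => (1 - t) • x + t • y := by fun_prop
  have hcont : Continuous fun t : ℝ => fderiv ℝ v ((1 - t) • x + t • y) (y - x) :=
    ((hv.continuous_fderiv (by simp)).comp hcl).clm_apply continuous_const
  have hftc := intervalIntegral.integral_eq_sub_of_hasDerivAt (a := 0) (b := 1)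
    (fun t _ => hder t) (hcont.intervalIntegrable _ _)
  have hcg : Continuous fun t : ℝ => gradient v ((1 - t) • x + t • y) :=
    hv.continuous_gradient.comp hcl
  have e1 : ‖v x - v y‖ₑ ≤
      ∫⁻ t in Ioo (0 : ℝ) 1, ‖x - y‖ₑ * ‖gradient v ((1 - t) • x + t • y)‖ₑ := by
    have : v y - v x = ∫ t in (0 : ℝ)..1, fderiv ℝ v ((1 - t) • x + t • y) (y - x) := by
      rw [hftc]; simp
    rw [← enorm_neg, neg_sub, this, intervalIntegral.integral_of_le zero_le_one,
      integral_Ioc_eq_integral_Ioo]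
    refine (enorm_integral_le_lintegral_enorm _).trans (lintegral_mono fun t => ?_)
    rw [← inner_gradient_left, ← ofReal_norm, ← ofReal_norm, ← ofReal_norm,
      ← ENNReal.ofReal_mul (norm_nonneg _), mul_comm, norm_sub_rev x y]
    exact ENNReal.ofReal_le_ofReal (norm_inner_le_norm _ _)
  calc ‖v x - v y‖ₑ ^ 2
      ≤ (∫⁻ t in Ioo (0 : ℝ) 1, ‖x - y‖ₑ * ‖gradient v ((1 - t) • x + t • y)‖ₑ) ^ 2 := by
        gcongr
    _ ≤ _ := by
        refine (sq_lintegral_le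
          (hcg.enorm.measurable.const_mul _).aemeasurable).trans (le_of_eq ?_)
        simp only [mul_pow]
        rw [lintegral_const_mul _ (hcg.enorm.measurable.pow_const 2)]
        simp

/-- Convexity keeps the intermediate point in S. For t ≥ 1/2 substitute in y, with Jacobian at most
2^d; for t < 1/2 exchange x and y, so that no factor blows up at either end. -/
theorem Measurable.lintegral_lintegral_comp_segment_le {d : ℕ} {h : RSpace d → ℝ≥0∞}
    (hm : Measurable h) {S : Set (RSpace d)} (hS : MeasurableSet S) (hconv : Convex ℝ S) {t : ℝ}
    (ht : t ∈ Ioo (0 : ℝ) 1) :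
    ∫⁻ x in S, ∫⁻ y in S, h ((1 - t) • x + t • y) ≤ 2 ^ d * (volume S * ∫⁻ x in S, h x) := by
  have hmain : ∀ t : ℝ, 1 / 2 ≤ t → t < 1 →
      ∫⁻ x in S, ∫⁻ y in S, h ((1 - t) • x + t • y) ≤
        2 ^ d * (volume S * ∫⁻ x in S, h x) := by
    intro t ht ht1
    calc ∫⁻ x in S, ∫⁻ y in S, h ((1 - t) • x + t • y)
        ≤ ∫⁻ x in S, 2 ^ d * ∫⁻ y in S, h y := by
          refine setLIntegral_mono measurable_const fun x hx => ?_
          refine setLIntegral_comp_add_smul_le hm hS _ ht fun y hy => ?_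
          exact hconv hx hy (by linarith) (by linarith) (by ring)
      _ = _ := by rw [setLIntegral_const]; ring
  by_cases h2 : 1 / 2 ≤ t
  · exact hmain t h2 ht.2
  · rw [lintegral_lintegral_swap]
    · have := hmain (1 - t) (by linarith) (by linarith [ht.1])
      simpa only [sub_sub_cancel, add_comm] using this
    · refine Measurable.aemeasurable (hm.comp (Continuous.measurable ?_))
      fun_prop

theorem Measurable.lintegral_lintegral_lintegral_segment_le {d : ℕ} {h : RSpace d → ℝ≥0∞}
    (hm : Measurable h) {S : Set (RSpace d)} (hS : MeasurableSet S) (hconv : Convex ℝ S) :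
    ∫⁻ x in S, ∫⁻ y in S, ∫⁻ t in Ioo (0 : ℝ) 1, h ((1 - t) • x + t • y) ≤
      2 ^ d * (volume S * ∫⁻ x in S, h x) := by
  have e1 : ∀ x, ∫⁻ y in S, ∫⁻ t in Ioo (0 : ℝ) 1, h ((1 - t) • x + t • y) =
      ∫⁻ t in Ioo (0 : ℝ) 1, ∫⁻ y in S, h ((1 - t) • x + t • y) := fun x => by
    refine lintegral_lintegral_swap
      (Measurable.aemeasurable (hm.comp (Continuous.measurable ?_)))
    fun_prop
  have hm2 : Measurable fun p : RSpace d × ℝ =>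
      ∫⁻ y in S, h ((1 - p.2) • p.1 + p.2 • y) := by
    refine Measurable.lintegral_prod_right'
      (f := fun q : (RSpace d × ℝ) × RSpace d => h ((1 - q.1.2) • q.1.1 + q.1.2 • q.2))
      (hm.comp (Continuous.measurable ?_))
    fun_prop
  simp only [e1]
  rw [lintegral_lintegral_swap hm2.aemeasurable]
  calc ∫⁻ t in Ioo (0 : ℝ) 1, ∫⁻ x in S, ∫⁻ y in S, h ((1 - t) • x + t • y)
      ≤ ∫⁻ t in Ioo (0 : ℝ) 1, 2 ^ d * (volume S * ∫⁻ x in S, h x) :=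
        setLIntegral_mono measurable_const fun t ht =>
          hm.lintegral_lintegral_comp_segment_le hS hconv ht
    _ = _ := by
        rw [setLIntegral_const]
        simp

theorem lintegral_lintegral_enorm_sub_sq_le_of_segment {d : ℕ} {v : RSpace d → ℝ}
    {h : RSpace d → ℝ≥0∞} (hm : Measurable h)
    (hv : ∀ x y, ‖v x - v y‖ₑ ^ 2 ≤
      ‖x - y‖ₑ ^ 2 * ∫⁻ t in Ioo (0 : ℝ) 1, h ((1 - t) • x + t • y))
    {S : Set (RSpace d)} (hS : MeasurableSet S) (hconv : Convex ℝ S)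
    {D : ℝ≥0∞} (hD : ∀ x ∈ S, ∀ y ∈ S, ‖x - y‖ₑ ≤ D) :
    ∫⁻ x in S, ∫⁻ y in S, ‖v x - v y‖ₑ ^ 2 ≤
      D ^ 2 * (2 ^ d * (volume S * ∫⁻ x in S, h x)) := by
  let k : RSpace d → RSpace d → ℝ≥0∞ := fun x y =>
    ∫⁻ t in Ioo (0 : ℝ) 1, h ((1 - t) • x + t • y)
  have hm1 : Measurable fun p : RSpace d × RSpace d => k p.1 p.2 := by
    refine Measurable.lintegral_prod_right' (f := fun q : (RSpace d × RSpace d) × ℝ =>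
      h ((1 - q.2) • q.1.1 + q.2 • q.1.2)) (hm.comp (Continuous.measurable ?_))
    fun_prop
  have hm2 : ∀ x, Measurable (k x) := fun x => hm1.comp measurable_prodMk_left
  calc ∫⁻ x in S, ∫⁻ y in S, ‖v x - v y‖ₑ ^ 2
      ≤ ∫⁻ x in S, ∫⁻ y in S, D ^ 2 * k x y := by
        refine setLIntegral_mono ?_ fun x hx => ?_
        · exact (hm1.const_mul _).lintegral_prod_right'
        refine setLIntegral_mono ((hm2 x).const_mul _) fun y hy => ?_
        refine (hv x y).trans ?_
        gcongr
        exact hD x hx y hy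
    _ = D ^ 2 * ∫⁻ x in S, ∫⁻ y in S, k x y := by
        rw [← lintegral_const_mul _ hm1.lintegral_prod_right']
        exact lintegral_congr fun x => lintegral_const_mul _ (hm2 x)
    _ ≤ _ := by
        gcongr
        exact hm.lintegral_lintegral_lintegral_segment_le hS hconv

/-- A Poincaré inequality on convex sets, for smooth functions. -/
theorem ContDiff.lintegral_lintegral_enorm_sub_sq_le {d : ℕ} {v : RSpace d → ℝ}
    (hv : ContDiff ℝ ∞ v) {S : Set (RSpace d)} (hS : MeasurableSet S) (hconv : Convex ℝ S)
    {D : ℝ≥0∞} (hD : ∀ x ∈ S, ∀ y ∈ S, ‖x - y‖ₑ ≤ D) :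
    ∫⁻ x in S, ∫⁻ y in S, ‖v x - v y‖ₑ ^ 2 ≤
      D ^ 2 * (2 ^ d * (volume S * ∫⁻ x in S, ‖gradient v x‖ₑ ^ 2)) :=
  lintegral_lintegral_enorm_sub_sq_le_of_segment
    (hv.continuous_gradient.enorm.measurable.pow_const 2) hv.enorm_sub_sq_le hS hconv hD

/-- A Poincaré inequality on convex sets, for limits of smooth functions. -/
theorem lintegral_lintegral_enorm_sub_sq_le {d : ℕ} {S : Set (RSpace d)}
    (hS : MeasurableSet S) (hSvol : volume S ≠ ⊤) (hconv : Convex ℝ S)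
    {D : ℝ≥0∞} (hDtop : D ≠ ⊤) (hD : ∀ x ∈ S, ∀ y ∈ S, ‖x - y‖ₑ ≤ D)
    {u : RSpace d → ℝ} {G : RSpace d → RSpace d}
    (hu : AEStronglyMeasurable u (volume.restrict S))
    (hG : AEStronglyMeasurable G (volume.restrict S))
    (happ : ∀ ε : ℝ≥0∞, 0 < ε → ∃ v : RSpace d → ℝ, ContDiff ℝ ∞ v ∧
      ∫⁻ x in S, ‖v x - u x‖ₑ ^ 2 ≤ ε ∧ ∫⁻ x in S, ‖gradient v x - G x‖ₑ ^ 2 ≤ ε) :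
    ∫⁻ x in S, ∫⁻ y in S, ‖u x - u y‖ₑ ^ 2 ≤
      8 * (D ^ 2 * (2 ^ d * (volume S * ∫⁻ x in S, ‖G x‖ₑ ^ 2))) := by
  refine ENNReal.le_of_forall_le_add_mul
    (A := 8 * volume S + 8 * (D ^ 2 * (2 ^ d * volume S))) ?_ fun ε hε => ?_
  · finiteness
  obtain ⟨v, hv, h1, h2⟩ := happ ε hε
  have hvc := hv.continuous
  -- Comparing u with v at both points costs a factor 4 on the smooth term, and comparing the two
  -- gradients costs another 2: this is the 8 of the conclusion.
  have hp : ∀ x y, ‖u x - u y‖ₑ ^ 2 ≤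
      4 * ‖v x - u x‖ₑ ^ 2 + (4 * ‖v x - v y‖ₑ ^ 2 + 4 * ‖v y - u y‖ₑ ^ 2) := fun x y => by
    have e1 : u x - u y = -(v x - u x) + ((v x - v y) + (v y - u y)) := by ring
    rw [e1]
    refine (enorm_add_sq_le _ _).trans ?_
    rw [enorm_neg]
    calc 2 * ‖v x - u x‖ₑ ^ 2 + 2 * ‖v x - v y + (v y - u y)‖ₑ ^ 2
        ≤ 4 * ‖v x - u x‖ₑ ^ 2 +
          2 * (2 * ‖v x - v y‖ₑ ^ 2 + 2 * ‖v y - u y‖ₑ ^ 2) := by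
          gcongr
          · norm_num
          · exact enorm_add_sq_le _ _
      _ = _ := by ring
  have hgrad : ∫⁻ x in S, ‖gradient v x‖ₑ ^ 2 ≤ 2 * ε + 2 * ∫⁻ x in S, ‖G x‖ₑ ^ 2 := by
    calc ∫⁻ x in S, ‖gradient v x‖ₑ ^ 2
        ≤ ∫⁻ x in S, (2 * ‖gradient v x - G x‖ₑ ^ 2 + 2 * ‖G x‖ₑ ^ 2) := by
          refine lintegral_mono fun x => ?_
          simpa using enorm_add_sq_le (gradient v x - G x) (G x)
      _ = 2 * (∫⁻ x in S, ‖gradient v x - G x‖ₑ ^ 2) + 2 * ∫⁻ x in S, ‖G x‖ₑ ^ 2 := by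
          rw [lintegral_add_right' _ ((hG.enorm.pow_const 2).const_mul 2),
            lintegral_const_mul' _ _ (by simp), lintegral_const_mul' _ _ (by simp)]
      _ ≤ _ := by gcongr
  have hvu : AEMeasurable (fun x => ‖v x - u x‖ₑ ^ 2) (volume.restrict S) :=
    (hvc.aestronglyMeasurable.sub hu).enorm.pow_const 2
  calc ∫⁻ x in S, ∫⁻ y in S, ‖u x - u y‖ₑ ^ 2
      ≤ ∫⁻ x in S, ∫⁻ y in S,
          (4 * ‖v x - u x‖ₑ ^ 2 + (4 * ‖v x - v y‖ₑ ^ 2 + 4 * ‖v y - u y‖ₑ ^ 2)) :=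
        lintegral_mono fun x => lintegral_mono fun y => hp x y
    _ = ∫⁻ x in S, (4 * volume S * ‖v x - u x‖ₑ ^ 2 +
          (4 * (∫⁻ y in S, ‖v x - v y‖ₑ ^ 2) + 4 * ∫⁻ y in S, ‖v y - u y‖ₑ ^ 2)) := by
        refine lintegral_congr fun x => ?_
        rw [lintegral_add_left measurable_const, lintegral_add_right' _ (hvu.const_mul 4),
          setLIntegral_const, lintegral_const_mul' _ _ (by simp),
          lintegral_const_mul' _ _ (by simp)]
        ring
    _ = 4 * volume S * (∫⁻ x in S, ‖v x - u x‖ₑ ^ 2) +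
          (4 * (∫⁻ x in S, ∫⁻ y in S, ‖v x - v y‖ₑ ^ 2) +
            4 * (∫⁻ y in S, ‖v y - u y‖ₑ ^ 2) * volume S) := by
        rw [lintegral_add_left' (hvu.const_mul _), lintegral_add_right _ measurable_const,
          setLIntegral_const, lintegral_const_mul' (4 * volume S) _ (ENNReal.mul_ne_top (by simp) hSvol),
          lintegral_const_mul' 4 _ (by simp)]
    _ ≤ 4 * volume S * ε + (4 * (D ^ 2 * (2 ^ d * (volume S *
          (2 * ε + 2 * ∫⁻ x in S, ‖G x‖ₑ ^ 2)))) + 4 * ε * volume S) := by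
        gcongr
        refine (hv.lintegral_lintegral_enorm_sub_sq_le hS hconv hD).trans ?_
        gcongr
    _ = _ := by ring

/-! ### Averages over balls and their convergence -/

/-- Jensen's inequality for the mean of u - c, with the measure of s multiplied out to avoid
division. -/
theorem enorm_setAverage_sub_sq_mul_le {X : Type*} [MeasurableSpace X] {μ : Measure X}
    {s : Set X} (hs0 : μ s ≠ 0) (hs : μ s ≠ ⊤) {u : X → ℝ} (hu : IntegrableOn u s μ) (c : ℝ) :
    ‖(⨍ y in s, u y ∂μ) - c‖ₑ ^ 2 * μ s ≤ ∫⁻ y in s, ‖u y - c‖ₑ ^ 2 ∂μ := by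
  have hc : IntegrableOn (fun _ => c) s μ := integrableOn_const hs
  have hr : μ.real s ≠ 0 := by simp [Measure.real, ENNReal.toReal_eq_zero_iff, hs0, hs]
  have e1 : μ.real s * ((⨍ y in s, u y ∂μ) - c) = ∫ y in s, (u y - c) ∂μ := by
    rw [integral_sub hu hc, setAverage_eq, setIntegral_const, smul_eq_mul, smul_eq_mul]
    field_simp
  have e2 : μ s * ‖(⨍ y in s, u y ∂μ) - c‖ₑ ≤ ∫⁻ y in s, ‖u y - c‖ₑ ∂μ := by
    have h := enorm_integral_le_lintegral_enorm (μ := μ.restrict s) fun y => u y - c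
    rw [← e1, enorm_mul, Real.enorm_of_nonneg measureReal_nonneg, ofReal_measureReal hs] at h
    exact h
  have e3 : (μ s * ‖(⨍ y in s, u y ∂μ) - c‖ₑ) ^ 2 ≤
      μ s * ∫⁻ y in s, ‖u y - c‖ₑ ^ 2 ∂μ := by
    refine (pow_le_pow_left' e2 2).trans ((sq_lintegral_le ?_).trans (le_of_eq ?_))
    · exact (hu.aestronglyMeasurable.sub hc.aestronglyMeasurable).enorm
    · simp
  have e4 : (μ s * ‖(⨍ y in s, u y ∂μ) - c‖ₑ) ^ 2 =
      μ s * (‖(⨍ y in s, u y ∂μ) - c‖ₑ ^ 2 * μ s) := by ring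
  rw [e4] at e3
  exact (ENNReal.mul_le_mul_iff_right hs0 hs).1 e3

/-- Jensen in y with the constant c = u x, integrated over x; this turns the double-integral form of
Poincaré into a bound on the deviation from a mean. -/
theorem lintegral_enorm_sub_setAverage_mul_le {X : Type*} [MeasurableSpace X] {μ : Measure X}
    {s t : Set X} (hts : t ⊆ s) (ht0 : μ t ≠ 0) (ht : μ t ≠ ⊤)
    {u : X → ℝ} (hu : IntegrableOn u s μ) :
    (∫⁻ x in s, ‖u x - ⨍ y in t, u y ∂μ‖ₑ ^ 2 ∂μ) * μ t ≤
      ∫⁻ x in s, ∫⁻ y in s, ‖u x - u y‖ₑ ^ 2 ∂μ ∂μ := by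
  rw [← lintegral_mul_const' _ _ ht]
  refine lintegral_mono fun x => ?_
  have h := enorm_setAverage_sub_sq_mul_le ht0 ht (hu.mono_set hts) (u x)
  have hn : ∀ a b : ℝ, ‖a - b‖ₑ = ‖b - a‖ₑ := fun a b => by rw [← enorm_neg, neg_sub]
  simp only
  rw [hn]
  refine h.trans ((lintegral_mono_set hts).trans (le_of_eq ?_))
  exact lintegral_congr fun y => by rw [hn]

theorem enorm_setAverage_sub_setAverage_sq_mul_le {X : Type*} [MeasurableSpace X]
    {μ : Measure X} {s t : Set X} (hts : t ⊆ s) (ht0 : μ t ≠ 0) (hs : μ s ≠ ⊤)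
    {u : X → ℝ} (hu : IntegrableOn u s μ) :
    ‖(⨍ y in s, u y ∂μ) - ⨍ y in t, u y ∂μ‖ₑ ^ 2 * μ s * μ t ≤
      ∫⁻ x in s, ∫⁻ y in s, ‖u x - u y‖ₑ ^ 2 ∂μ ∂μ := by
  have hs0 : μ s ≠ 0 := fun h => ht0 (measure_mono_null hts h)
  have ht : μ t ≠ ⊤ := ((measure_mono hts).trans_lt hs.lt_top).ne
  refine le_trans ?_ (lintegral_enorm_sub_setAverage_mul_le hts ht0 ht hu)
  gcongr
  exact enorm_setAverage_sub_sq_mul_le hs0 hs hu _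

/-- Dyadic chaining. -/
theorem abs_sub_le_of_dyadic {A : ℝ → ℝ} {N β ρ : ℝ} (hN : 0 ≤ N) (hβ : 0 < β)
    (h : ∀ s, 0 < s → s ≤ ρ → ∀ δ, s / 2 ≤ δ → δ ≤ s → |A s - A δ| ≤ N * s ^ β)
    {s δ : ℝ} (hs : s ≤ ρ) (hδ : 0 < δ) (hδs : δ ≤ s) :
    |A s - A δ| ≤ N * s ^ β / (1 - 2 ^ (-β)) := by
  have hq1 : (2 : ℝ) ^ (-β) < 1 := Real.rpow_lt_one_of_one_lt_of_neg (by norm_num) (by linarith)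
  have hq0 : (0 : ℝ) < 2 ^ (-β) := by positivity
  -- Induct on the number of halvings leading from s down to δ; each one multiplies the bound by
  -- 2^(-β), and the sum is a geometric series.
  obtain ⟨n, hn⟩ : ∃ n : ℕ, s / 2 ^ n ≤ δ := by
    obtain ⟨n, hn⟩ := pow_unbounded_of_one_lt (s / δ) (one_lt_two (α := ℝ))
    refine ⟨n, ?_⟩
    rw [div_lt_iff₀ hδ] at hn
    rw [div_le_iff₀ (by positivity)]
    linarith
  induction n generalizing s with
  | zero =>
    have : δ = s := le_antisymm hδs (by simpa using hn)
    subst this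
    simp only [sub_self, abs_zero]
    have : 0 < 1 - (2 : ℝ) ^ (-β) := by linarith
    positivity
  | succ n ih =>
    have hs0 : 0 < s := hδ.trans_le hδs
    have hNs : 0 ≤ N * s ^ β := by positivity
    have h1q : 0 < 1 - (2 : ℝ) ^ (-β) := by linarith
    by_cases hc : s / 2 ≤ δ
    · refine (h s hs0 hs δ hc hδs).trans ?_
      rw [le_div_iff₀ h1q]
      nlinarith
    · push Not at hc
      have h1 := h s hs0 hs (s / 2) le_rfl (by linarith)
      have h2 := ih (s := s / 2) (by linarith) hc.le (by
        rw [div_div, ← pow_succ']; exact hn)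
      have h3 : (s / 2) ^ β = s ^ β * 2 ^ (-β) := by
        rw [Real.div_rpow hs0.le (by norm_num), Real.rpow_neg (by norm_num)]; rfl
      rw [h3] at h2
      calc |A s - A δ| ≤ |A s - A (s / 2)| + |A (s / 2) - A δ| := abs_sub_le _ _ _
        _ ≤ N * s ^ β + N * (s ^ β * 2 ^ (-β)) / (1 - 2 ^ (-β)) := add_le_add h1 h2
        _ = _ := by field_simp; ring

/-- The right-hand side tends to 0 with s because β > 0, so the values form a Cauchy filter at 0⁺;
letting δ → 0 in the hypothesis at s = ρ gives the rate. -/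
theorem exists_tendsto_of_abs_sub_le {A : ℝ → ℝ} {N β ρ : ℝ} (hβ : 0 < β)
    (hρ : 0 < ρ)
    (h : ∀ s δ, s ≤ ρ → 0 < δ → δ ≤ s → |A s - A δ| ≤ N * s ^ β) :
    ∃ L, Tendsto A (𝓝[>] 0) (𝓝 L) ∧ |A ρ - L| ≤ N * ρ ^ β := by
  have hlim : Tendsto (fun s : ℝ => N * s ^ β) (𝓝[>] 0) (𝓝 0) := by
    have h1 : Tendsto (fun s : ℝ => N * s ^ β) (𝓝 0) (𝓝 (N * 0 ^ β)) :=
      ((Real.continuousAt_rpow_const 0 β (Or.inr hβ.le)).tendsto).const_mul N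
    rw [Real.zero_rpow hβ.ne', mul_zero] at h1
    exact h1.mono_left nhdsWithin_le_nhds
  have hc : Cauchy (map A (𝓝[>] 0)) := by
    rw [Metric.cauchy_iff]
    refine ⟨inferInstance, fun ε hε => ?_⟩
    obtain ⟨s, hs⟩ := ((hlim.eventually (gt_mem_nhds (half_pos hε))).and
      (Ioc_mem_nhdsGT hρ)).exists
    refine ⟨A '' Ioc 0 s, image_mem_map (Ioc_mem_nhdsGT hs.2.1), ?_⟩
    rintro _ ⟨a, ha, rfl⟩ _ ⟨b, hb, rfl⟩
    have h1 := h s a hs.2.2 ha.1 ha.2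
    have h2 := h s b hs.2.2 hb.1 hb.2
    rw [abs_sub_comm] at h1
    rw [Real.dist_eq]
    calc |A a - A b| ≤ |A a - A s| + |A s - A b| := abs_sub_le _ _ _
      _ < ε := by linarith [hs.1]
  obtain ⟨L, hL⟩ := CompleteSpace.complete hc
  refine ⟨L, hL, ?_⟩
  have h3 : Tendsto (fun δ => |A ρ - A δ|) (𝓝[>] 0) (𝓝 |A ρ - L|) :=
    ((show Tendsto A (𝓝[>] 0) (𝓝 L) from hL).const_sub (A ρ)).abs
  refine le_of_tendsto h3 ?_
  filter_upwards [Ioc_mem_nhdsGT hρ] with δ hδ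
  exact h ρ δ le_rfl hδ.1 hδ.2

theorem volume_ball_eq {d : ℕ} (hd : 1 ≤ d) (p : RSpace d) {s : ℝ} (hs : 0 ≤ s) :
    volume (Metric.ball p s) =
      ENNReal.ofReal (s ^ d) * volume (Metric.ball (0 : RSpace d) 1) := by
  have : Nonempty (Fin d) := ⟨⟨0, hd⟩⟩
  rw [Measure.addHaar_ball volume p hs, finrank_euclideanSpace_fin]

/-- Decay of the mean oscillation gives convergence of the averages, with a rate. -/
theorem exists_tendsto_setAverage_ball {d : ℕ} (hd : 1 ≤ d) {u : RSpace d → ℝ} {p : RSpace d}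
    {ρ K β : ℝ} (hρ : 0 < ρ) (hK : 0 ≤ K) (hβ : 0 < β)
    (hu : IntegrableOn u (Metric.ball p ρ))
    (hW : ∀ s, 0 < s → s ≤ ρ → ∫⁻ x in Metric.ball p s, ∫⁻ y in Metric.ball p s,
      ‖u x - u y‖ₑ ^ 2 ≤ volume (Metric.ball p s) ^ 2 * ENNReal.ofReal (K * s ^ (2 * β))) :
    ∃ L, Tendsto (fun s => ⨍ y in Metric.ball p s, u y) (𝓝[>] 0) (𝓝 L) ∧
      ∫⁻ y in Metric.ball p ρ, ‖u y - L‖ₑ ^ 2 ≤ volume (Metric.ball p ρ) *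
        ENNReal.ofReal ((2 + 2 * (2 ^ d / (1 - 2 ^ (-β)) ^ 2)) * (K * ρ ^ (2 * β))) := by
  set A : ℝ → ℝ := fun s => ⨍ y in Metric.ball p s, u y with hA
  have hB0 : ∀ s, 0 < s → volume (Metric.ball p s) ≠ 0 := fun s hs =>
    (Metric.measure_ball_pos volume p hs).ne'
  have hBt : ∀ s, volume (Metric.ball p s) ≠ ⊤ := fun s => measure_ball_lt_top.ne
  have hsq : ∀ s : ℝ, 0 < s → s ^ (2 * β) = (s ^ β) ^ 2 := fun s hs => by
    rw [mul_comm, Real.rpow_mul hs.le]; norm_cast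
  -- K is the oscillation constant, and 2^d bounds |B(p,s)| / |B(p,δ)| for δ ≥ s/2.
  set N : ℝ := Real.sqrt (2 ^ d * K) with hN
  have hN2 : N ^ 2 = 2 ^ d * K := Real.sq_sqrt (by positivity)
  have hstep : ∀ s, 0 < s → s ≤ ρ → ∀ δ, s / 2 ≤ δ → δ ≤ s → |A s - A δ| ≤ N * s ^ β := by
    intro s hs hsρ δ hδ hδs
    have hδ0 : 0 < δ := by linarith
    have h1 := enorm_setAverage_sub_setAverage_sq_mul_le (μ := volume)
      (Metric.ball_subset_ball (x := p) hδs) (hB0 δ hδ0) (hBt s)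
      (hu.mono_set (Metric.ball_subset_ball hsρ))
    have h2 := h1.trans (hW s hs hsρ)
    have h3 : volume (Metric.ball p s) ≤ 2 ^ d * volume (Metric.ball p δ) := by
      rw [volume_ball_eq hd p hs.le, volume_ball_eq hd p hδ0.le, ← mul_assoc]
      gcongr
      have e2 : (2 : ℝ≥0∞) ^ d = ENNReal.ofReal (2 ^ d) := by
        rw [ENNReal.ofReal_pow (by norm_num)]; simp
      rw [e2, ← ENNReal.ofReal_mul (by positivity), ← mul_pow]
      refine ENNReal.ofReal_le_ofReal ?_
      gcongr
      linarith
    have h4 : ‖A s - A δ‖ₑ ^ 2 * volume (Metric.ball p s) ^ 2 ≤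
        (2 ^ d * ENNReal.ofReal (K * s ^ (2 * β))) * volume (Metric.ball p s) ^ 2 := by
      calc ‖A s - A δ‖ₑ ^ 2 * volume (Metric.ball p s) ^ 2
          = ‖A s - A δ‖ₑ ^ 2 * volume (Metric.ball p s) * volume (Metric.ball p s) := by ring
        _ ≤ ‖A s - A δ‖ₑ ^ 2 * volume (Metric.ball p s) *
            (2 ^ d * volume (Metric.ball p δ)) := by gcongr
        _ = 2 ^ d * (‖A s - A δ‖ₑ ^ 2 * volume (Metric.ball p s) *
            volume (Metric.ball p δ)) := by ring
        _ ≤ 2 ^ d * (volume (Metric.ball p s) ^ 2 * ENNReal.ofReal (K * s ^ (2 * β))) := by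
            gcongr
        _ = _ := by ring
    have h5 := (ENNReal.mul_le_mul_iff_left (pow_ne_zero 2 (hB0 s hs))
      (ENNReal.pow_ne_top (hBt s))).1 h4
    have h6 : |A s - A δ| ^ 2 ≤ (N * s ^ β) ^ 2 := by
      rw [mul_pow, hN2, ← hsq s hs, mul_assoc]
      have e2 : (2 : ℝ≥0∞) ^ d = ENNReal.ofReal (2 ^ d) := by
        rw [ENNReal.ofReal_pow (by norm_num)]; simp
      rw [Real.enorm_eq_ofReal_abs, ← ENNReal.ofReal_pow (abs_nonneg _), e2,
        ← ENNReal.ofReal_mul (by positivity)] at h5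
      exact (ENNReal.ofReal_le_ofReal_iff (by positivity)).1 h5
    exact (pow_le_pow_iff_left₀ (abs_nonneg _) (by positivity) two_ne_zero).1 h6
  have hq1 : (2 : ℝ) ^ (-β) < 1 := Real.rpow_lt_one_of_one_lt_of_neg (by norm_num) (by linarith)
  have h1q : 0 < 1 - (2 : ℝ) ^ (-β) := by linarith
  obtain ⟨L, hL, hLρ⟩ := exists_tendsto_of_abs_sub_le (A := A) (N := N / (1 - 2 ^ (-β))) hβ hρ
    (fun s δ hs hδ hδs => by
      rw [div_mul_eq_mul_div]
      exact abs_sub_le_of_dyadic (Real.sqrt_nonneg _) hβ hstep hs hδ hδs)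
  refine ⟨L, hL, ?_⟩
  -- Split u - L into u - A ρ, controlled by the oscillation, and A ρ - L, controlled by the
  -- chaining; their squares give the two terms of the constant.
  have g1 : ∫⁻ y in Metric.ball p ρ, ‖u y - A ρ‖ₑ ^ 2 ≤
      volume (Metric.ball p ρ) * ENNReal.ofReal (K * ρ ^ (2 * β)) := by
    have h := (lintegral_enorm_sub_setAverage_mul_le (μ := volume) (Subset.refl _)
      (hB0 ρ hρ) (hBt ρ) hu).trans (hW ρ hρ le_rfl)
    rw [sq, mul_assoc, mul_comm] at h
    exact (ENNReal.mul_le_mul_iff_right (hB0 ρ hρ) (hBt ρ)).1 h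
  have g2 : ‖A ρ - L‖ₑ ^ 2 ≤
      ENNReal.ofReal (2 ^ d / (1 - 2 ^ (-β)) ^ 2 * (K * ρ ^ (2 * β))) := by
    rw [Real.enorm_eq_ofReal_abs, ← ENNReal.ofReal_pow (abs_nonneg _)]
    refine ENNReal.ofReal_le_ofReal ((pow_le_pow_left₀ (abs_nonneg _) hLρ 2).trans (le_of_eq ?_))
    rw [mul_pow, div_pow, hN2, hsq ρ hρ]
    ring
  calc ∫⁻ y in Metric.ball p ρ, ‖u y - L‖ₑ ^ 2
      ≤ ∫⁻ y in Metric.ball p ρ, (2 * ‖u y - A ρ‖ₑ ^ 2 + 2 * ‖A ρ - L‖ₑ ^ 2) := by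
        refine lintegral_mono fun y => ?_
        simpa using enorm_add_sq_le (u y - A ρ) (A ρ - L)
    _ = 2 * (∫⁻ y in Metric.ball p ρ, ‖u y - A ρ‖ₑ ^ 2) +
          2 * ‖A ρ - L‖ₑ ^ 2 * volume (Metric.ball p ρ) := by
        rw [lintegral_add_right _ measurable_const, setLIntegral_const,
          lintegral_const_mul' _ _ (by simp)]
    _ ≤ 2 * (volume (Metric.ball p ρ) * ENNReal.ofReal (K * ρ ^ (2 * β))) +
          2 * ENNReal.ofReal (2 ^ d / (1 - 2 ^ (-β)) ^ 2 * (K * ρ ^ (2 * β))) *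
            volume (Metric.ball p ρ) := by gcongr
    _ = _ := by
        rw [add_mul, ENNReal.ofReal_add (by positivity) (by positivity), mul_assoc (2 : ℝ),
          ENNReal.ofReal_mul (p := (2 : ℝ)) (by norm_num),
          ENNReal.ofReal_mul (p := (2 : ℝ)) (by norm_num)]
        simp only [ENNReal.ofReal_ofNat]
        ring

/-! ### The weight near a singular point and existence of the trace -/

theorem IsMinSeparation.infDist_eq {d : ℕ} {Γ : Set (RSpace d)} {R : ℝ}
    (hR : IsMinSeparation Γ R) {p y : RSpace d} (hp : p ∈ Γ) (hy : dist y p ≤ R / 2) :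
    Metric.infDist y Γ = dist y p := by
  refine le_antisymm (Metric.infDist_le_dist_of_mem hp) ?_
  refine (Metric.le_infDist ⟨p, hp⟩).2 fun q hq => ?_
  by_cases hqp : q = p
  · rw [hqp]
  · have h1 : R ≤ dist q p := (hR.2 ⟨q, hq, p, hp, hqp⟩).2 ⟨q, hq, p, hp, hqp, rfl⟩
    have h2 := dist_triangle q y p
    rw [dist_comm q y] at h2
    linarith

/-- Near a singular point the weight is an explicit radial function. -/
theorem IsAdmissibleWeight.exists_ball {d : ℕ} {Ω Γ : Set (RSpace d)} {r₀ α R : ℝ}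
    {γ : RSpace d → ℝ} (hγ : IsAdmissibleWeight Ω Γ r₀ α R γ) (hΩ : IsOpen Ω) (hΓΩ : Γ ⊆ Ω)
    (hR : IsMinSeparation Γ R) {p : RSpace d} (hp : p ∈ Γ) :
    ∃ ρ > 0, Metric.ball p ρ ⊆ Ω ∧
      ∀ y ∈ Metric.ball p ρ, y ≠ p → γ y = 1 + (r₀ / dist y p) ^ α := by
  obtain ⟨ρ, hρ, hρΩ⟩ := Metric.isOpen_iff.1 hΩ p (hΓΩ hp)
  have hR0 := hR.1
  refine ⟨min ρ (R / 4), by positivity, (Metric.ball_subset_ball (min_le_left _ _)).trans hρΩ,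
    fun y hy hyp => ?_⟩
  have h1 : dist y p < ρ := lt_of_lt_of_le hy (min_le_left _ _)
  have h2 : dist y p < R / 4 := lt_of_lt_of_le hy (min_le_right _ _)
  have h3 := hR.infDist_eq hp (y := y) (by linarith)
  have hyΓ : y ∉ Γ := fun hyΓ => by
    rw [Metric.infDist_zero_of_mem hyΓ] at h3
    exact hyp (dist_eq_zero.1 h3.symm)
  rw [hγ.eq_near y ⟨subset_closure (hρΩ h1), hyΓ⟩ (by rw [h3]; exact h2.le), h3]

/-- Since |y - p| < s and α ≥ 0, γ y exceeds (r₀/s)^α. This yields the gain s^α when unweighted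
energy is bounded by weighted energy on a ball. -/
theorem ofReal_mul_enorm_sq_le_of_weight {d : ℕ} {γ : RSpace d → ℝ} {p y : RSpace d}
    {r₀ α s : ℝ} (hr₀ : 0 < r₀) (hα : 0 ≤ α) (hyp : y ≠ p) (hys : dist y p < s)
    (hγ : γ y = 1 + (r₀ / dist y p) ^ α) :
    1 ≤ ENNReal.ofReal ((s / r₀) ^ α) * ENNReal.ofReal (γ y) := by
  have h0 : 0 < dist y p := dist_pos.2 hyp
  have hs : 0 < s := h0.trans hys
  rw [← ENNReal.ofReal_mul (by positivity), ← ENNReal.ofReal_one]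
  refine ENNReal.ofReal_le_ofReal ?_
  rw [hγ]
  have h1 : 1 ≤ (s / r₀) ^ α * (r₀ / dist y p) ^ α := by
    rw [← Real.mul_rpow (by positivity) (by positivity)]
    refine Real.one_le_rpow ?_ hα
    rw [div_mul_div_cancel₀ hr₀.ne', one_le_div h0]
    exact hys.le
  nlinarith [show (0 : ℝ) ≤ (s / r₀) ^ α by positivity]

/-- Existence of the trace at a singular point, with a quantitative estimate. -/
theorem exists_trace {d : ℕ} (hd : 1 ≤ d) {Ω Γ : Set (RSpace d)} (hΩ : IsOpen Ω)
    (hlip : HasLipschitzBoundary Ω) (hΓΩ : Γ ⊆ Ω) {R r₀ α : ℝ} (hR : IsMinSeparation Γ R)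
    (hr₀ : 0 < r₀) (hα0 : 0 ≤ α) (hα : (d : ℝ) - 2 < α) {γ : RSpace d → ℝ}
    (hγ : IsAdmissibleWeight Ω Γ r₀ α R γ) {p : RSpace d} (hp : p ∈ Γ) :
    ∃ ρ > 0, Metric.ball p ρ ⊆ Ω ∧ ∃ C : ℝ, 0 ≤ C ∧
      ∀ (u : RSpace d → ℝ) (G : RSpace d → RSpace d), IsWeakGradient Ω u G →
      MemLp u 2 (volume.restrict Ω) → MemLp G 2 (volume.restrict Ω) →
      ∫⁻ x in Ω, ENNReal.ofReal (γ x) * ‖G x‖ₑ ^ 2 < ⊤ →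
      ∃ L, Tendsto (fun s => ⨍ y in Metric.ball p s, u y) (𝓝[>] 0) (𝓝 L) ∧
        ∀ s, 0 < s → s < ρ → ∫⁻ y in Metric.ball p s, ‖u y - L‖ₑ ^ 2 ≤
          ENNReal.ofReal (C * s ^ (2 + α)) *
            ∫⁻ y in Metric.ball p s, ENNReal.ofReal (γ y) * ‖G y‖ₑ ^ 2 := by
  have hne : Nonempty (Fin d) := ⟨⟨0, hd⟩⟩
  obtain ⟨ρ₁, hρ₁, hρΩ, hγp⟩ := hγ.exists_ball hΩ hΓΩ hR hp
  obtain ⟨ρ₂, hρ₂, happ⟩ := exists_local_smooth_approx hΩ hlip (subset_closure (hΓΩ hp))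
  set b : ℝ := volume.real (Metric.ball (0 : RSpace d) 1) with hb
  have hb0 : 0 < b := ENNReal.toReal_pos (Metric.measure_ball_pos volume _ one_pos).ne'
    measure_ball_lt_top.ne
  have hvol : ∀ s : ℝ, 0 ≤ s → volume (Metric.ball p s) = ENNReal.ofReal (s ^ d * b) :=
    fun s hs => by
      rw [volume_ball_eq hd p hs, ENNReal.ofReal_mul (by positivity), hb,
        ofReal_measureReal measure_ball_lt_top.ne]
  -- The factors s² from Poincaré and s^α from the weight, over one surplus volume s^d, leave
  -- s^(2β).
  set β : ℝ := (2 + α - d) / 2 with hβdef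
  have hβ : 0 < β := by rw [hβdef]; linarith
  set Q : ℝ := 2 + 2 * (2 ^ d / (1 - 2 ^ (-β)) ^ 2) with hQ
  have hQ0 : 0 ≤ Q := by positivity
  -- The factors 8 and 2^d come from Poincaré, 2² from the diameter 2t, and r₀^α from the weight.
  set C₁ : ℝ := 8 * 2 ^ 2 * 2 ^ d / r₀ ^ α with hC₁
  have hC₁0 : 0 ≤ C₁ := by positivity
  refine ⟨min ρ₁ ρ₂, lt_min hρ₁ hρ₂, (Metric.ball_subset_ball (min_le_left _ _)).trans hρΩ,
    Q * C₁, by positivity, fun u G hu hu2 hG2 hfin => ?_⟩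
  have main : ∀ s, 0 < s → s < min ρ₁ ρ₂ →
      ∃ L, Tendsto (fun s => ⨍ y in Metric.ball p s, u y) (𝓝[>] 0) (𝓝 L) ∧
        ∫⁻ y in Metric.ball p s, ‖u y - L‖ₑ ^ 2 ≤
          ENNReal.ofReal (Q * C₁ * s ^ (2 + α)) *
            ∫⁻ y in Metric.ball p s, ENNReal.ofReal (γ y) * ‖G y‖ₑ ^ 2 := by
    intro s hs hsρ
    have hsub : ∀ t, t ≤ s → Metric.ball p t ⊆ Ω ∩ Metric.ball p ρ₂ := fun t ht =>
      subset_inter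
        ((Metric.ball_subset_ball (ht.trans (hsρ.le.trans (min_le_left _ _)))).trans hρΩ)
        (Metric.ball_subset_ball (ht.trans (hsρ.le.trans (min_le_right _ _))))
    have hsubΩ : ∀ t, t ≤ s → Metric.ball p t ⊆ Ω := fun t ht => (hsub t ht).trans inter_subset_left
    set M : ℝ≥0∞ := ∫⁻ y in Metric.ball p s, ENNReal.ofReal (γ y) * ‖G y‖ₑ ^ 2 with hM
    have hMtop : M ≠ ⊤ := ((lintegral_mono_set (hsubΩ s le_rfl)).trans_lt hfin).ne
    -- The energy of the largest ball B(p,s) serves all smaller radii. Rerunning the argument for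
    -- each s keeps the local energy in the final bound; the limits agree by uniqueness.
    set K : ℝ := C₁ / b * M.toReal with hK
    have hK0 : 0 ≤ K := by positivity
    have hpow : ∀ t : ℝ, 0 < t → t ^ d * t ^ (2 * β) = t ^ 2 * t ^ α := fun t ht => by
      rw [← Real.rpow_natCast t d, ← Real.rpow_natCast t 2, ← Real.rpow_add ht,
        ← Real.rpow_add ht]
      congr 1
      rw [hβdef]
      push_cast
      ring
    have hfinB : IsFiniteMeasure (volume.restrict (Metric.ball p s)) :=
      ⟨by simpa using measure_ball_lt_top⟩
    have hui : IntegrableOn u (Metric.ball p s) :=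
      (hu2.mono_measure (Measure.restrict_mono (hsubΩ s le_rfl) le_rfl)).integrable
        (by norm_num)
    have hW : ∀ t, 0 < t → t ≤ s → ∫⁻ x in Metric.ball p t, ∫⁻ y in Metric.ball p t,
        ‖u x - u y‖ₑ ^ 2 ≤
          volume (Metric.ball p t) ^ 2 * ENNReal.ofReal (K * t ^ (2 * β)) := by
      intro t ht hts
      have hGm : AEStronglyMeasurable G (volume.restrict (Metric.ball p t)) :=
        hG2.1.mono_measure (Measure.restrict_mono (hsubΩ t hts) le_rfl)
      have hum : AEStronglyMeasurable u (volume.restrict (Metric.ball p t)) :=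
        hu2.1.mono_measure (Measure.restrict_mono (hsubΩ t hts) le_rfl)
      have hP := lintegral_lintegral_enorm_sub_sq_le (S := Metric.ball p t)
        (D := ENNReal.ofReal (2 * t)) measurableSet_ball measure_ball_lt_top.ne
        (convex_ball p t) ENNReal.ofReal_ne_top (fun x hx y hy => ?_) hum hGm (fun ε hε => ?_)
      · refine hP.trans ?_
        have hGM : ∫⁻ x in Metric.ball p t, ‖G x‖ₑ ^ 2 ≤ ENNReal.ofReal ((t / r₀) ^ α) * M := by
          calc ∫⁻ x in Metric.ball p t, ‖G x‖ₑ ^ 2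
              ≤ ∫⁻ x in Metric.ball p t, ENNReal.ofReal ((t / r₀) ^ α) *
                  (ENNReal.ofReal (γ x) * ‖G x‖ₑ ^ 2) := by
                refine lintegral_mono_ae ?_
                rw [ae_restrict_iff' measurableSet_ball]
                filter_upwards [Measure.ae_ne volume p] with x hxp hx
                have hxρ : x ∈ Metric.ball p ρ₁ := Metric.ball_subset_ball
                  (hts.trans (hsρ.le.trans (min_le_left _ _))) hx
                have := ofReal_mul_enorm_sq_le_of_weight hr₀ hα0 hxp hx (hγp x hxρ hxp)
                calc ‖G x‖ₑ ^ 2 = 1 * ‖G x‖ₑ ^ 2 := (one_mul _).symm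
                  _ ≤ _ := by rw [← mul_assoc]; gcongr
            _ ≤ _ := by
                rw [lintegral_const_mul' _ _ ENNReal.ofReal_ne_top]
                gcongr
                exact lintegral_mono_set (Metric.ball_subset_ball hts)
        calc 8 * (ENNReal.ofReal (2 * t) ^ 2 * (2 ^ d * (volume (Metric.ball p t) *
              ∫⁻ x in Metric.ball p t, ‖G x‖ₑ ^ 2)))
            ≤ 8 * (ENNReal.ofReal (2 * t) ^ 2 * (2 ^ d * (volume (Metric.ball p t) *
              (ENNReal.ofReal ((t / r₀) ^ α) * M)))) := by gcongr
          _ = _ := by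
            have e2 : (2 : ℝ≥0∞) ^ d = ENNReal.ofReal (2 ^ d) := by
              rw [ENNReal.ofReal_pow (by norm_num)]; simp
            have e8 : (8 : ℝ≥0∞) = ENNReal.ofReal 8 := by simp
            rw [hvol t ht.le, ← ENNReal.ofReal_toReal hMtop, e2, e8,
              ← ENNReal.ofReal_pow (by positivity), ← ENNReal.ofReal_pow (by positivity),
              ← ENNReal.ofReal_mul (by positivity), ← ENNReal.ofReal_mul (by positivity),
              ← ENNReal.ofReal_mul (by positivity), ← ENNReal.ofReal_mul (by positivity),
              ← ENNReal.ofReal_mul (by positivity), ← ENNReal.ofReal_mul (by positivity)]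
            congr 1
            rw [hK, hC₁, Real.div_rpow ht.le hr₀.le]
            have h3 : (t ^ d * b) ^ 2 * (8 * 2 ^ 2 * 2 ^ d / r₀ ^ α / b * M.toReal *
              t ^ (2 * β)) = t ^ d * b * (8 * 2 ^ 2 * 2 ^ d / r₀ ^ α * M.toReal) *
                (t ^ d * t ^ (2 * β)) := by field_simp
            rw [h3, hpow t ht]
            ring
      · rw [← ofReal_norm]
        refine ENNReal.ofReal_le_ofReal ?_
        rw [Metric.mem_ball] at hx hy
        rw [← dist_eq_norm]
        linarith [dist_triangle_right x y p]
      · obtain ⟨v, hv, h1, h2⟩ := happ u G hu hu2 hG2 ε hε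
        exact ⟨v, hv, (lintegral_mono_set (hsubΩ t hts)).trans h1,
          (lintegral_mono_set (hsub t hts)).trans h2⟩
    obtain ⟨L, hL, hLs⟩ := exists_tendsto_setAverage_ball hd hs hK0 hβ hui hW
    refine ⟨L, hL, hLs.trans (le_of_eq ?_)⟩
    rw [hvol s hs.le, ← ENNReal.ofReal_toReal hMtop, ← ENNReal.ofReal_mul (by positivity),
      ← ENNReal.ofReal_mul (by positivity)]
    congr 1
    have h1 : s ^ (2 + α) = s ^ 2 * s ^ α := by
      rw [Real.rpow_add hs]; norm_cast
    rw [h1, ← hpow s hs, hK, ← hQ]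
    field_simp
  obtain ⟨L, hL, -⟩ := main (min ρ₁ ρ₂ / 2) (by positivity)
    (half_lt_self (lt_min hρ₁ hρ₂))
  refine ⟨L, hL, fun s hs hsρ => ?_⟩
  obtain ⟨L', hL', h⟩ := main s hs hsρ
  rwa [tendsto_nhds_unique hL hL']

/-! ### The squared norm and stability of H¹ -/

/-- The square of `h1GammaNorm`. -/
noncomputable def h1GammaSq {d : ℕ} (Ω : Set (RSpace d)) (γ : RSpace d → ℝ)
    (u : RSpace d → ℝ) : ℝ≥0∞ :=
  (∫⁻ x in Ω, ‖u x‖ₑ ^ 2) + h1GammaSemiSq Ω γ u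

theorem h1GammaNorm_lt_iff {d : ℕ} {Ω : Set (RSpace d)} {γ u : RSpace d → ℝ} {ε : ℝ≥0∞} :
    h1GammaNorm Ω γ u < ε ↔ h1GammaSq Ω γ u < ε ^ 2 := by
  rw [show h1GammaNorm Ω γ u = h1GammaSq Ω γ u ^ (1 / 2 : ℝ) from rfl, one_div,
    ENNReal.rpow_inv_lt_iff (by norm_num), ENNReal.rpow_two]

theorem IsAdmissibleWeight.aemeasurable {d : ℕ} (hd : 1 ≤ d) {Ω Γ : Set (RSpace d)}
    {r₀ α R : ℝ} {γ : RSpace d → ℝ} (hγ : IsAdmissibleWeight Ω Γ r₀ α R γ) (hΩ : IsOpen Ω)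
    (hΓ : Γ.Finite) : AEMeasurable γ (volume.restrict Ω) := by
  have hne : Nonempty (Fin d) := ⟨⟨0, hd⟩⟩
  have h1 : (Ω \ Γ : Set (RSpace d)) =ᵐ[volume] Ω :=
    sdiff_null_ae_eq_self (hΓ.measure_zero volume)
  rw [← Measure.restrict_congr_set h1]
  exact (hγ.smooth.continuousOn.mono (sdiff_subset_sdiff_left subset_closure)).aemeasurable
    (hΩ.measurableSet.diff hΓ.measurableSet)

namespace IsWeakGradient

variable {d : ℕ} {Ω : Set (RSpace d)} {u w γ : RSpace d → ℝ} {G H : RSpace d → RSpace d}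

theorem congr (hΩ : IsOpen Ω) (hu : IsWeakGradient Ω u G) (h : EqOn u w Ω) :
    IsWeakGradient Ω w G := by
  refine ⟨hu.1.congr ?_, hu.2.1, fun φ hφ hc hs v => ?_⟩
  · exact (ae_restrict_iff' hΩ.measurableSet).2 (Eventually.of_forall h)
  · rw [← hu.2.2 φ hφ hc hs v]
    exact setIntegral_congr_fun hΩ.measurableSet fun x hx => by simp only [h hx]

theorem zero : IsWeakGradient Ω (0 : RSpace d → ℝ) 0 := by
  refine ⟨?_, ?_, fun φ _ _ _ v => by simp⟩
  · exact (locallyIntegrable_zero).locallyIntegrableOn _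
  · exact (locallyIntegrable_zero).locallyIntegrableOn _

/-- By uniqueness almost everywhere, the energy may be computed with any weak gradient at hand
instead of the chosen one. -/
theorem h1GammaSq_eq (hΩ : IsOpen Ω) (hu : IsWeakGradient Ω u G) :
    h1GammaSq Ω γ u =
      (∫⁻ x in Ω, ‖u x‖ₑ ^ 2) + ∫⁻ x in Ω, ENNReal.ofReal (γ x) * ‖G x‖ₑ ^ 2 := by
  rw [h1GammaSq, h1GammaSemiSq]
  congr 1
  refine lintegral_congr_ae ?_
  filter_upwards [hu.weakGradient_ae_eq hΩ] with x hx
  rw [hx]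

theorem h1GammaSq_congr (hΩ : IsOpen Ω) (hu : IsWeakGradient Ω u G) (h : EqOn u w Ω) :
    h1GammaSq Ω γ w = h1GammaSq Ω γ u := by
  rw [hu.h1GammaSq_eq hΩ, (hu.congr hΩ h).h1GammaSq_eq hΩ]
  congr 1
  exact setLIntegral_congr_fun hΩ.measurableSet fun x hx => by simp only [h hx]

/-- A triangle inequality up to the factor 2, enough for all limit arguments and free of square
roots. -/
theorem h1GammaSq_add_le (hΩ : IsOpen Ω) (hγ : AEMeasurable γ (volume.restrict Ω))
    (hu : IsWeakGradient Ω u G) (hw : IsWeakGradient Ω w H) :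
    h1GammaSq Ω γ (fun x => u x + w x) ≤ 2 * h1GammaSq Ω γ u + 2 * h1GammaSq Ω γ w := by
  rw [hu.h1GammaSq_eq hΩ, hw.h1GammaSq_eq hΩ, (hu.add hw).h1GammaSq_eq hΩ]
  have hum : AEMeasurable (fun x => ‖u x‖ₑ ^ 2) (volume.restrict Ω) :=
    hu.1.aestronglyMeasurable.enorm.pow_const 2
  have hGm : AEMeasurable (fun x => ENNReal.ofReal (γ x) * ‖G x‖ₑ ^ 2) (volume.restrict Ω) :=
    hγ.ennreal_ofReal.mul (hu.2.1.aestronglyMeasurable.enorm.pow_const 2)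
  have h1 : ∫⁻ x in Ω, ‖u x + w x‖ₑ ^ 2 ≤
      2 * (∫⁻ x in Ω, ‖u x‖ₑ ^ 2) + 2 * ∫⁻ x in Ω, ‖w x‖ₑ ^ 2 := by
    rw [← lintegral_const_mul' _ _ (by simp), ← lintegral_const_mul' _ _ (by simp),
      ← lintegral_add_left' (hum.const_mul 2)]
    exact lintegral_mono fun x => enorm_add_sq_le _ _
  have h2 : ∫⁻ x in Ω, ENNReal.ofReal (γ x) * ‖G x + H x‖ₑ ^ 2 ≤
      2 * (∫⁻ x in Ω, ENNReal.ofReal (γ x) * ‖G x‖ₑ ^ 2) +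
        2 * ∫⁻ x in Ω, ENNReal.ofReal (γ x) * ‖H x‖ₑ ^ 2 := by
    rw [← lintegral_const_mul' _ _ (by simp), ← lintegral_const_mul' _ _ (by simp),
      ← lintegral_add_left' (hGm.const_mul 2)]
    refine lintegral_mono fun x => ?_
    calc ENNReal.ofReal (γ x) * ‖G x + H x‖ₑ ^ 2
        ≤ ENNReal.ofReal (γ x) * (2 * ‖G x‖ₑ ^ 2 + 2 * ‖H x‖ₑ ^ 2) := by
          gcongr
          exact enorm_add_sq_le _ _
      _ = _ := by ring
  refine (add_le_add h1 h2).trans (le_of_eq ?_)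
  ring

end IsWeakGradient

theorem H1.sub_mem {d : ℕ} {Ω : Set (RSpace d)} {u w : RSpace d → ℝ} (hu : u ∈ H1 Ω)
    (hw : w ∈ H1 Ω) : (fun x => u x - w x) ∈ H1 Ω := by
  obtain ⟨hu2, G, hG, hG2⟩ := hu
  obtain ⟨hw2, H, hH, hH2⟩ := hw
  exact ⟨hu2.sub hw2, _, hG.sub hH, hG2.sub hH2⟩

theorem H1.add_mem {d : ℕ} {Ω : Set (RSpace d)} {u w : RSpace d → ℝ} (hu : u ∈ H1 Ω)
    (hw : w ∈ H1 Ω) : (fun x => u x + w x) ∈ H1 Ω := by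
  obtain ⟨hu2, G, hG, hG2⟩ := hu
  obtain ⟨hw2, H, hH, hH2⟩ := hw
  exact ⟨hu2.add hw2, _, hG.add hH, hG2.add hH2⟩

theorem H1.zero_mem {d : ℕ} {Ω : Set (RSpace d)} : (0 : RSpace d → ℝ) ∈ H1 Ω :=
  ⟨MemLp.zero, 0, IsWeakGradient.zero, MemLp.zero⟩

theorem HasCompactSupport.gradient {d : ℕ} {b : RSpace d → ℝ} (hc : HasCompactSupport b) :
    HasCompactSupport (gradient b) :=
  (hc.fderiv ℝ).comp_left (g := (InnerProductSpace.toDual ℝ (RSpace d)).symm) (map_zero _)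

theorem H1.smooth_mul_mem {d : ℕ} {Ω : Set (RSpace d)} (hΩ : IsOpen Ω) {u b : RSpace d → ℝ}
    (hu : u ∈ H1 Ω) (hb : ContDiff ℝ ∞ b) (hc : HasCompactSupport b) :
    (fun x => b x * u x) ∈ H1 Ω := by
  obtain ⟨hu2, G, hG, hG2⟩ := hu
  have hbt : MemLp b ⊤ (volume.restrict Ω) :=
    (hb.continuous.memLp_top_of_hasCompactSupport hc volume).mono_measure Measure.restrict_le_self
  have hgt : MemLp (gradient b) ⊤ (volume.restrict Ω) :=
    (hb.continuous_gradient.memLp_top_of_hasCompactSupport hc.gradient volume).mono_measure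
      Measure.restrict_le_self
  exact ⟨hu2.mul' hbt, _, hG.smooth_mul hΩ hb, (hG2.smul hbt).add (hgt.smul hu2)⟩

theorem H1.of_contDiff {d : ℕ} {Ω : Set (RSpace d)} {φ : RSpace d → ℝ} (hφ : ContDiff ℝ ∞ φ)
    (hc : HasCompactSupport φ) : φ ∈ H1 Ω :=
  ⟨(hφ.continuous.memLp_of_hasCompactSupport hc).mono_measure Measure.restrict_le_self, _,
    IsWeakGradient.of_contDiff hφ,
    (hφ.continuous_gradient.memLp_of_hasCompactSupport hc.gradient).mono_measure
      Measure.restrict_le_self⟩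

/-! ### Approximation by test functions away from the singular set -/

/-- The approximation property that defines `H1GammaZero`. -/
def IsTestLimit {d : ℕ} (Ω Γ : Set (RSpace d)) (γ : RSpace d → ℝ) (u : RSpace d → ℝ) : Prop :=
  ∀ ε : ℝ≥0∞, 0 < ε → ∃ φ ∈ testFunctions Γ, h1GammaSq Ω γ (fun x => u x - φ x) ≤ ε

theorem isTestLimit_zero {d : ℕ} {Ω Γ : Set (RSpace d)} {γ : RSpace d → ℝ} (hΩ : IsOpen Ω) :
    IsTestLimit Ω Γ γ 0 := by
  intro ε hε
  refine ⟨0, ⟨contDiff_const, HasCompactSupport.zero, by simp⟩, ?_⟩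
  have h : (fun x => (0 : RSpace d → ℝ) x - (0 : RSpace d → ℝ) x) = 0 := by ext; simp
  rw [h, IsWeakGradient.zero.h1GammaSq_eq hΩ]
  simp

theorem IsTestLimit.add {d : ℕ} {Ω Γ : Set (RSpace d)} {γ u w : RSpace d → ℝ} (hΩ : IsOpen Ω)
    (hγ : AEMeasurable γ (volume.restrict Ω)) (hu : u ∈ H1 Ω) (hw : w ∈ H1 Ω)
    (hua : IsTestLimit Ω Γ γ u) (hwa : IsTestLimit Ω Γ γ w) :
    IsTestLimit Ω Γ γ (fun x => u x + w x) := by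
  intro ε hε
  have hε4 : 0 < ε / 4 := ENNReal.div_pos hε.ne' (by simp)
  obtain ⟨φ, hφ, h1⟩ := hua (ε / 4) hε4
  obtain ⟨ψ, hψ, h2⟩ := hwa (ε / 4) hε4
  refine ⟨fun x => φ x + ψ x, ⟨hφ.1.add hψ.1, hφ.2.1.add hψ.2.1, ?_⟩, ?_⟩
  · refine Disjoint.mono_left (tsupport_add φ ψ) ?_
    exact disjoint_union_left.2 ⟨hφ.2.2, hψ.2.2⟩
  · obtain ⟨-, G, hG, -⟩ := hu
    obtain ⟨-, H, hH, -⟩ := hw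
    have h := (hG.sub (IsWeakGradient.of_contDiff hφ.1)).h1GammaSq_add_le hΩ hγ
      (hH.sub (IsWeakGradient.of_contDiff hψ.1))
    have e : (fun x => u x + w x - (φ x + ψ x)) = fun x => u x - φ x + (w x - ψ x) := by
      ext x; ring
    rw [e]
    refine h.trans ?_
    calc 2 * h1GammaSq Ω γ (fun x => u x - φ x) + 2 * h1GammaSq Ω γ (fun x => w x - ψ x)
        ≤ 2 * (ε / 4) + 2 * (ε / 4) := by gcongr
      _ = ε / 4 * 4 := by ring
      _ = ε := ENNReal.div_mul_cancel (by simp) (by simp)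

/-- Away from the singular set the weight is bounded, and truncations to small balls are limits of
test functions. -/
theorem exists_bump_isTestLimit {d : ℕ} {Ω Γ : Set (RSpace d)} (hΩ : IsOpen Ω)
    (hlip : HasLipschitzBoundary Ω) (hΓ : IsClosed Γ) {γ : RSpace d → ℝ}
    (hγ : ContinuousOn γ (closure Ω \ Γ)) {x₀ : RSpace d} (hx₀ : x₀ ∈ closure Ω)
    (hx₀Γ : x₀ ∉ Γ) :
    ∃ b : RSpace d → ℝ, ContDiff ℝ ∞ b ∧ HasCompactSupport b ∧ (∀ᶠ x in 𝓝 x₀, b x = 1) ∧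
      ∀ u ∈ H1 Ω, IsTestLimit Ω Γ γ (fun x => b x * u x) := by
  obtain ⟨r, hr, happ⟩ := exists_local_smooth_approx hΩ hlip hx₀
  obtain ⟨r', hr', hr'Γ⟩ := Metric.isOpen_iff.1 hΓ.isOpen_compl x₀ hx₀Γ
  set ρ : ℝ := min r r' / 2 with hρ
  have hρ0 : 0 < ρ := by positivity
  have hρr : ρ < r := (half_lt_self (lt_min hr hr')).trans_le (min_le_left _ _)
  have hρr' : ρ < r' := (half_lt_self (lt_min hr hr')).trans_le (min_le_right _ _)
  obtain ⟨b, hb, hbc, hb1, hb01, hbs⟩ : ∃ b : RSpace d → ℝ, ContDiff ℝ ∞ b ∧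
      HasCompactSupport b ∧ (∀ᶠ x in 𝓝 x₀, b x = 1) ∧ (∀ x, ‖b x‖ ≤ 1) ∧
      tsupport b ⊆ Metric.closedBall x₀ ρ := by
    let B : ContDiffBump x₀ := ⟨ρ / 2, ρ, by positivity, by linarith⟩
    refine ⟨B, B.contDiff, B.hasCompactSupport, B.eventuallyEq_one, fun x => ?_,
      B.tsupport_eq.subset⟩
    rw [Real.norm_of_nonneg B.nonneg]
    exact B.le_one
  refine ⟨b, hb, hbc, hb1, fun u hu => ?_⟩
  obtain ⟨hu2, G, hG, hG2⟩ := hu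
  -- The closed ball of radius ρ misses Γ, so γ is continuous, hence bounded, on this compact piece
  -- of the closure.
  obtain ⟨M, hM⟩ : ∃ M : ℝ, ∀ x ∈ closure Ω ∩ Metric.closedBall x₀ ρ, γ x ≤ M := by
    have hc : IsCompact (closure Ω ∩ Metric.closedBall x₀ ρ) :=
      (isCompact_closedBall x₀ ρ).inter_left isClosed_closure
    have hs : closure Ω ∩ Metric.closedBall x₀ ρ ⊆ closure Ω \ Γ := fun x hx =>
      ⟨hx.1, hr'Γ (Metric.closedBall_subset_ball hρr' hx.2)⟩
    obtain ⟨M, hM⟩ := hc.bddAbove_image (hγ.mono hs)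
    exact ⟨M, fun x hx => hM (mem_image_of_mem _ hx)⟩
  obtain ⟨C, hC⟩ := hb.continuous_gradient.bounded_above_of_compact_support hbc.gradient
  set A : ℝ≥0∞ := 1 + ENNReal.ofReal M * (2 + 2 * ENNReal.ofReal C ^ 2) with hA
  have hA0 : A ≠ 0 := by simp [hA]
  have hAt : A ≠ ⊤ := by rw [hA]; finiteness
  intro ε hε
  obtain ⟨v, hv, h1, h2⟩ := happ u G hG hu2 hG2 (ε / A) (ENNReal.div_pos hε.ne' hAt)
  refine ⟨fun x => b x * v x, ⟨hb.mul hv, hbc.mul_right, ?_⟩, ?_⟩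
  · refine Disjoint.mono_left (tsupport_mul_subset_left.trans hbs) ?_
    rw [disjoint_left]
    exact fun x hx => hr'Γ (Metric.closedBall_subset_ball hρr' hx)
  have hw := (hG.smooth_mul hΩ hb).sub ((IsWeakGradient.of_contDiff hv).smooth_mul hΩ hb)
  rw [hw.h1GammaSq_eq hΩ]
  have k1 : ∫⁻ x in Ω, ‖b x * u x - b x * v x‖ₑ ^ 2 ≤ ε / A := by
    refine (lintegral_mono fun x => ?_).trans h1
    have e1 : b x * u x - b x * v x = -(b x * (v x - u x)) := by ring
    rw [e1, enorm_neg, enorm_mul, mul_pow]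
    refine mul_le_of_le_one_left' (pow_le_one' ?_ 2)
    rw [← ofReal_norm, ← ENNReal.ofReal_one]
    exact ENNReal.ofReal_le_ofReal (hb01 x)
  -- The gradient error is -b(∇v - G) - (v - u)∇b. It vanishes off the closed ball, so control of ∇v
  -- - G on the larger ball of radius r is enough.
  have k2 : ∀ x ∈ Ω, ENNReal.ofReal (γ x) *
      ‖b x • G x + u x • gradient b x - (b x • gradient v x + v x • gradient b x)‖ₑ ^ 2 ≤
      (Metric.ball x₀ r).indicator (fun x => ENNReal.ofReal M * 2 * ‖gradient v x - G x‖ₑ ^ 2) x +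
        ENNReal.ofReal M * 2 * ENNReal.ofReal C ^ 2 * ‖v x - u x‖ₑ ^ 2 := by
    intro x hx
    by_cases hxs : x ∈ Metric.closedBall x₀ ρ
    · rw [indicator_of_mem (Metric.closedBall_subset_ball hρr hxs)]
      have e1 : b x • G x + u x • gradient b x - (b x • gradient v x + v x • gradient b x) =
          (-b x) • (gradient v x - G x) + (-(v x - u x)) • gradient b x := by
        module
      rw [e1]
      calc ENNReal.ofReal (γ x) *
            ‖(-b x) • (gradient v x - G x) + (-(v x - u x)) • gradient b x‖ₑ ^ 2
          ≤ ENNReal.ofReal M * (2 * (1 * ‖gradient v x - G x‖ₑ) ^ 2 +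
              2 * (‖v x - u x‖ₑ * ENNReal.ofReal C) ^ 2) := by
            gcongr
            · exact hM x ⟨subset_closure hx, hxs⟩
            · refine (enorm_add_sq_le _ _).trans ?_
              rw [enorm_smul, enorm_smul, enorm_neg, enorm_neg]
              gcongr
              · rw [← ofReal_norm, ← ENNReal.ofReal_one]
                exact ENNReal.ofReal_le_ofReal (hb01 x)
              · rw [← ofReal_norm]
                exact ENNReal.ofReal_le_ofReal (hC x)
        _ = _ := by ring
    · have hb0 : b x = 0 := image_eq_zero_of_notMem_tsupport fun h => hxs (hbs h)
      have hg0 : gradient b x = 0 := by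
        have : x ∉ tsupport (fderiv ℝ b) := fun h => hxs (hbs (tsupport_fderiv_subset ℝ h))
        rw [gradient, image_eq_zero_of_notMem_tsupport this, map_zero]
      simp [hb0, hg0]
  have hum : AEMeasurable (fun x => ‖v x - u x‖ₑ ^ 2) (volume.restrict Ω) :=
    (hv.continuous.aestronglyMeasurable.sub hu2.1).enorm.pow_const 2
  have k3 : ∫⁻ x in Ω, ENNReal.ofReal (γ x) *
      ‖b x • G x + u x • gradient b x - (b x • gradient v x + v x • gradient b x)‖ₑ ^ 2 ≤
      ENNReal.ofReal M * 2 * (ε / A) + ENNReal.ofReal M * 2 * ENNReal.ofReal C ^ 2 * (ε / A) := by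
    refine (lintegral_mono_ae ((ae_restrict_iff' hΩ.measurableSet).2
      (Eventually.of_forall k2))).trans ?_
    rw [lintegral_add_right' _ (hum.const_mul _), lintegral_indicator measurableSet_ball,
      Measure.restrict_restrict measurableSet_ball, inter_comm,
      lintegral_const_mul' (ENNReal.ofReal M * 2) _ (by finiteness),
      lintegral_const_mul' (ENNReal.ofReal M * 2 * ENNReal.ofReal C ^ 2) _ (by finiteness)]
    gcongr
  refine (add_le_add k1 k3).trans (le_of_eq ?_)
  calc ε / A + (ENNReal.ofReal M * 2 * (ε / A) +
        ENNReal.ofReal M * 2 * ENNReal.ofReal C ^ 2 * (ε / A)) = ε / A * A := by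
        rw [hA]; ring
    _ = ε := ENNReal.div_mul_cancel hA0 hAt

/-- Compactness patches the local bumps together without an explicit partition of unity: being a
limit of test functions after multiplication passes to unions. -/
theorem exists_cutoff_isTestLimit {d : ℕ} {Ω Γ : Set (RSpace d)} (hΩ : IsOpen Ω)
    (hlip : HasLipschitzBoundary Ω) (hΓ : IsClosed Γ) {γ : RSpace d → ℝ}
    (hγ : ContinuousOn γ (closure Ω \ Γ)) (hγm : AEMeasurable γ (volume.restrict Ω))
    {K : Set (RSpace d)} (hK : IsCompact K) (hKΩ : K ⊆ closure Ω \ Γ) :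
    ∃ b : RSpace d → ℝ, ContDiff ℝ ∞ b ∧ HasCompactSupport b ∧ (∀ x ∈ K, b x = 1) ∧
      ∀ u ∈ H1 Ω, IsTestLimit Ω Γ γ (fun x => b x * u x) := by
  refine hK.induction_on (p := fun S => ∃ b : RSpace d → ℝ, ContDiff ℝ ∞ b ∧
    HasCompactSupport b ∧ (∀ x ∈ S, b x = 1) ∧
      ∀ u ∈ H1 Ω, IsTestLimit Ω Γ γ (fun x => b x * u x)) ?_ ?_ ?_ ?_
  · refine ⟨0, contDiff_const, HasCompactSupport.zero, by simp, fun u _ => ?_⟩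
    simp only [Pi.zero_apply, zero_mul]
    exact isTestLimit_zero hΩ
  · rintro s t hst ⟨b, hb, hbc, hb1, h⟩
    exact ⟨b, hb, hbc, fun x hx => hb1 x (hst hx), h⟩
  · rintro s t ⟨b, hb, hbc, hb1, h⟩ ⟨c, hc, hcc, hc1, h'⟩
    -- This equals 1 wherever b or c does, and its product with u is b u plus c times the H¹
    -- function u - b u.
    refine ⟨fun x => b x + c x * (1 - b x), hb.add (hc.mul (contDiff_const.sub hb)),
      hbc.add hcc.mul_right, ?_, fun u hu => ?_⟩
    · rintro x (hx | hx)
      · simp [hb1 x hx]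
      · simp [hc1 x hx]
    · have hbu := H1.smooth_mul_mem hΩ hu hb hbc
      have hsub := H1.sub_mem hu hbu
      have := (h u hu).add hΩ hγm hbu (H1.smooth_mul_mem hΩ hsub hc hcc) (h' _ hsub)
      convert this using 2
      ring
  · intro x hx
    obtain ⟨b, hb, hbc, hb1, h⟩ :=
      exists_bump_isTestLimit hΩ hlip hΓ hγ (hKΩ hx).1 (hKΩ hx).2
    exact ⟨{y | b y = 1}, mem_nhdsWithin_of_mem_nhds hb1, b, hb, hbc, fun y hy => hy, h⟩

/-- Functions in `H¹` vanishing near the singular set are limits of test functions. -/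
theorem isTestLimit_of_eqOn_zero {d : ℕ} {Ω Γ : Set (RSpace d)} (hΩ : IsOpen Ω)
    (hΩb : Bornology.IsBounded Ω)
    (hlip : HasLipschitzBoundary Ω) (hΓ : IsClosed Γ) {γ : RSpace d → ℝ}
    (hγ : ContinuousOn γ (closure Ω \ Γ)) (hγm : AEMeasurable γ (volume.restrict Ω))
    {U : Set (RSpace d)} (hU : IsOpen U) (hΓU : Γ ⊆ U) {w : RSpace d → ℝ} (hw : w ∈ H1 Ω)
    (hwU : ∀ x ∈ U, w x = 0) : IsTestLimit Ω Γ γ w := by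
  -- A cutoff equal to 1 on this compact set leaves w unchanged on Ω, as w vanishes on U.
  have hK : IsCompact (closure Ω \ U) := hΩb.isCompact_closure.diff hU
  obtain ⟨b, hb, hbc, hb1, h⟩ := exists_cutoff_isTestLimit hΩ hlip hΓ hγ hγm hK
    (sdiff_subset_sdiff_right hΓU)
  have hbw : EqOn w (fun x => b x * w x) Ω := fun x hx => by
    by_cases hxU : x ∈ U
    · simp [hwU x hxU]
    · simp [hb1 x ⟨subset_closure hx, hxU⟩]
  intro ε hε
  obtain ⟨φ, hφ, hφε⟩ := h w hw ε hε
  refine ⟨φ, hφ, ?_⟩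
  obtain ⟨-, G, hG, -⟩ := hw
  rwa [← (hG.sub (IsWeakGradient.of_contDiff hφ.1)).h1GammaSq_congr hΩ
    (fun x hx => congrArg (· - φ x) (hbw hx))]

/-! ### Cutting off at the singular points -/

theorem ContDiff.gradient_comp_smul_sub {d : ℕ} {ψ : RSpace d → ℝ} (hψ : ContDiff ℝ ∞ ψ)
    (c : ℝ) (p x : RSpace d) :
    gradient (fun x => ψ (c • (x - p))) x = c • gradient ψ (c • (x - p)) := by
  refine ext_inner_right ℝ fun v => ?_
  have e1 : HasFDerivAt ψ (fderiv ℝ ψ (c • (x - p))) (c • (x - p)) :=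
    (hψ.differentiable (by simp)).differentiableAt.hasFDerivAt
  have e2 : HasFDerivAt (fun x : RSpace d => c • (x - p))
      (c • ContinuousLinearMap.id ℝ (RSpace d)) x :=
    ((hasFDerivAt_id x).sub_const p).const_smul c
  have e3 : HasFDerivAt (fun x => ψ (c • (x - p))) _ x := e1.comp x e2
  rw [inner_gradient_left, e3.fderiv, inner_smul_left, inner_gradient_left]
  simp

/-- Rescaled cut-off functions with the expected gradient bound. -/
theorem exists_cutoff_family {d : ℕ} (p : RSpace d) :
    ∃ C : ℝ, 0 ≤ C ∧ ∃ f : ℝ → RSpace d → ℝ, ∀ δ, 0 < δ →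
      ContDiff ℝ ∞ (f δ) ∧ HasCompactSupport (f δ) ∧ (∀ x, ‖f δ x‖ ≤ 1) ∧
      (∀ x ∈ Metric.ball p δ, f δ x = 1) ∧ (∀ x, x ∉ Metric.ball p (2 * δ) → f δ x = 0) ∧
      (∀ x ∈ Metric.ball p δ, gradient (f δ) x = 0) ∧
      (∀ x, x ∉ Metric.ball p (2 * δ) → gradient (f δ) x = 0) ∧
      ∀ x, ‖gradient (f δ) x‖ ≤ C / δ := by
  let B : ContDiffBump (0 : RSpace d) := ⟨1, 2, by norm_num, by norm_num⟩
  have hB : ContDiff ℝ ∞ B := B.contDiff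
  obtain ⟨C, hC⟩ := hB.continuous_gradient.bounded_above_of_compact_support
    B.hasCompactSupport.gradient
  have hC0 : 0 ≤ C := (norm_nonneg _).trans (hC 0)
  refine ⟨C, hC0, fun δ x => B (δ⁻¹ • (x - p)), fun δ hδ => ?_⟩
  have hnorm : ∀ x, ‖δ⁻¹ • (x - p)‖ = dist x p / δ := fun x => by
    rw [norm_smul, norm_inv, Real.norm_of_nonneg hδ.le, dist_eq_norm]
    ring
  have hsm : ContDiff ℝ ∞ fun x => B (δ⁻¹ • (x - p)) :=
    hB.comp (ContDiff.const_smul δ⁻¹ (contDiff_id.sub contDiff_const))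
  have h1 : ∀ x ∈ Metric.ball p δ, B (δ⁻¹ • (x - p)) = 1 := fun x hx => by
    refine B.one_of_mem_closedBall ?_
    rw [mem_closedBall_zero_iff, hnorm, div_le_iff₀ hδ]
    rw [Metric.mem_ball] at hx
    change dist x p ≤ 1 * δ
    linarith
  have h0 : ∀ x, x ∉ Metric.ball p (2 * δ) → B (δ⁻¹ • (x - p)) = 0 := fun x hx => by
    refine B.zero_of_le_dist ?_
    rw [dist_zero_right, hnorm, le_div_iff₀ hδ]
    simpa using hx
  have hgrad : ∀ x, gradient (fun x => B (δ⁻¹ • (x - p))) x =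
      δ⁻¹ • gradient B (δ⁻¹ • (x - p)) := hB.gradient_comp_smul_sub δ⁻¹ p
  refine ⟨hsm, ?_, fun x => ?_, h1, h0, fun x hx => ?_, fun x hx => ?_, fun x => ?_⟩
  · exact HasCompactSupport.intro (isCompact_closedBall p (2 * δ)) fun x hx =>
      h0 x fun h => hx (Metric.ball_subset_closedBall h)
  · rw [Real.norm_of_nonneg B.nonneg]
    exact B.le_one
  · have : (fun x => B (δ⁻¹ • (x - p))) =ᶠ[𝓝 x] fun _ => (1 : ℝ) := by
      filter_upwards [Metric.isOpen_ball.mem_nhds hx] with y hy using h1 y hy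
    rw [gradient, this.fderiv_eq]
    simp
  -- The exterior includes the sphere, near which the cutoff is not constant; but 0 is its global
  -- minimum, so the gradient vanishes there too.
  · have hmin : IsLocalMin (fun x => B (δ⁻¹ • (x - p))) x := by
      refine Eventually.of_forall fun y => ?_
      change B (δ⁻¹ • (x - p)) ≤ B (δ⁻¹ • (y - p))
      rw [h0 x hx]
      exact B.nonneg
    rw [gradient, hmin.fderiv_eq_zero, map_zero]
  · rw [hgrad, norm_smul, norm_inv, Real.norm_of_nonneg hδ.le, div_eq_inv_mul]
    gcongr
    exact hC _

/-- Absolute continuity of the integral; for d ≥ 1 the volumes of the balls shrink to 0. -/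
theorem tendsto_lintegral_ball_zero {d : ℕ} (hd : 1 ≤ d) {Ω : Set (RSpace d)}
    {f : RSpace d → ℝ≥0∞} (hf : ∫⁻ x in Ω, f x ≠ ⊤) {p : RSpace d} {ρ : ℝ} (hρ : 0 < ρ)
    (hρΩ : Metric.ball p ρ ⊆ Ω) :
    Tendsto (fun s => ∫⁻ x in Metric.ball p s, f x) (𝓝[>] 0) (𝓝 0) := by
  have hvol : Tendsto (fun s => volume (Metric.ball p s)) (𝓝[>] 0) (𝓝 0) := by
    have h1 : Tendsto (fun s : ℝ => ENNReal.ofReal (s ^ d) *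
        volume (Metric.ball (0 : RSpace d) 1)) (𝓝 0)
        (𝓝 (ENNReal.ofReal (0 ^ d) * volume (Metric.ball (0 : RSpace d) 1))) := by
      refine ENNReal.Tendsto.mul_const ?_ (Or.inr measure_ball_lt_top.ne)
      exact ENNReal.tendsto_ofReal ((continuous_pow d).tendsto 0)
    rw [zero_pow (by omega), ENNReal.ofReal_zero, zero_mul] at h1
    refine (h1.mono_left nhdsWithin_le_nhds).congr' ?_
    filter_upwards [self_mem_nhdsWithin] with s hs
    rw [volume_ball_eq hd p (le_of_lt hs)]
  have hvol' : Tendsto (fun s => (volume.restrict Ω) (Metric.ball p s)) (𝓝[>] 0) (𝓝 0) :=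
    tendsto_of_tendsto_of_tendsto_of_le_of_le tendsto_const_nhds hvol (fun _ => zero_le)
      fun _ => Measure.restrict_apply_le _ _
  refine (tendsto_setLIntegral_zero hf hvol').congr' ?_
  filter_upwards [Ioc_mem_nhdsGT hρ] with s hs
  rw [Measure.restrict_restrict measurableSet_ball,
    inter_eq_left.2 ((Metric.ball_subset_ball hs.2).trans hρΩ)]

/-- Cutting off a function with vanishing trace near a singular point costs little energy. -/
theorem tendsto_h1GammaSq_cutoff {d : ℕ} (hd : 1 ≤ d) {Ω Γ : Set (RSpace d)} (hΩ : IsOpen Ω)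
    (hlip : HasLipschitzBoundary Ω) (hΓΩ : Γ ⊆ Ω) {R r₀ α : ℝ} (hR : IsMinSeparation Γ R)
    (hr₀ : 0 < r₀) (hα0 : 0 ≤ α) (hα : (d : ℝ) - 2 < α) {γ : RSpace d → ℝ}
    (hγ : IsAdmissibleWeight Ω Γ r₀ α R γ) {p : RSpace d} (hp : p ∈ Γ)
    {u : RSpace d → ℝ} (hu : u ∈ H1Gamma Ω γ)
    (hTr : Tendsto (fun s => ⨍ y in Metric.ball p s, u y) (𝓝[>] 0) (𝓝 0))
    {f : ℝ → RSpace d → ℝ} {C : ℝ}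
    (hf : ∀ δ, 0 < δ →
      ContDiff ℝ ∞ (f δ) ∧ HasCompactSupport (f δ) ∧ (∀ x, ‖f δ x‖ ≤ 1) ∧
      (∀ x ∈ Metric.ball p δ, f δ x = 1) ∧ (∀ x, x ∉ Metric.ball p (2 * δ) → f δ x = 0) ∧
      (∀ x ∈ Metric.ball p δ, gradient (f δ) x = 0) ∧
      (∀ x, x ∉ Metric.ball p (2 * δ) → gradient (f δ) x = 0) ∧
      ∀ x, ‖gradient (f δ) x‖ ≤ C / δ) :
    Tendsto (fun δ => h1GammaSq Ω γ (fun x => f δ x * u x)) (𝓝[>] 0) (𝓝 0) := by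
  have hne : Nonempty (Fin d) := ⟨⟨0, hd⟩⟩
  obtain ⟨⟨hu2, G, hG, hG2⟩, hfin⟩ := hu
  have hfin' : h1GammaSq Ω γ u < ⊤ := by
    have := h1GammaNorm_lt_iff.1 hfin
    simpa using this
  rw [hG.h1GammaSq_eq hΩ] at hfin'
  have hE : ∫⁻ x in Ω, ENNReal.ofReal (γ x) * ‖G x‖ₑ ^ 2 < ⊤ :=
    (le_add_self).trans_lt hfin'
  obtain ⟨ρ₁, hρ₁, -, hγp⟩ := hγ.exists_ball hΩ hΓΩ hR hp
  obtain ⟨ρ₂, hρ₂, hρΩ, C₂, hC₂, htr⟩ := exists_trace hd hΩ hlip hΓΩ hR hr₀ hα0 hα hγ hp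
  obtain ⟨L, hL, hLs⟩ := htr u G hG hu2 hG2 hE
  -- With L = 0 the trace estimate becomes the Hardy-type bound of ∫ u² over B(p,s) by C₂ s^(2+α)
  -- E(s).
  have hL0 : L = 0 := tendsto_nhds_unique hL hTr
  subst hL0
  simp only [sub_zero] at hLs
  set E : ℝ → ℝ≥0∞ := fun s =>
    ∫⁻ y in Metric.ball p s, ENNReal.ofReal (γ y) * ‖G y‖ₑ ^ 2 with hEdef
  have hE0 : Tendsto (fun δ : ℝ => E (2 * δ)) (𝓝[>] 0) (𝓝 0) := by
    refine (tendsto_lintegral_ball_zero hd hE.ne hρ₂ hρΩ).comp ?_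
    refine tendsto_nhdsWithin_of_tendsto_nhds_of_eventually_within _ ?_ ?_
    · have : Tendsto (fun δ : ℝ => 2 * δ) (𝓝 0) (𝓝 (2 * 0)) := tendsto_id.const_mul 2
      rw [mul_zero] at this
      exact this.mono_left nhdsWithin_le_nhds
    · filter_upwards [self_mem_nhdsWithin] with δ hδ
      have : (0 : ℝ) < δ := hδ
      simpa using this
  set Q : ℝ := C₂ * 2 ^ (2 + α) + (2 + 2 * ((1 + r₀ ^ α) * C ^ 2) * (C₂ * 2 ^ (2 + α))) with hQ
  have hlim : Tendsto (fun δ => ENNReal.ofReal Q * E (2 * δ)) (𝓝[>] 0) (𝓝 0) := by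
    simpa using ENNReal.Tendsto.const_mul (a := ENNReal.ofReal Q) hE0
      (Or.inr ENNReal.ofReal_ne_top)
  refine tendsto_of_tendsto_of_tendsto_of_le_of_le' tendsto_const_nhds hlim
    (Eventually.of_forall fun _ => zero_le) ?_
  -- The bound by 1 gives δ^α ≤ 1 below; the third keeps the ball of radius 2δ within both radii.
  have hm : 0 < min 1 (min ρ₁ ρ₂ / 3) := by positivity
  filter_upwards [Ioc_mem_nhdsGT hm] with δ hδ
  have hδ0 : 0 < δ := hδ.1
  have hδ1 : δ ≤ 1 := hδ.2.trans (min_le_left _ _)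
  have hδρ₁ : 2 * δ < ρ₁ := by
    have := hδ.2.trans ((min_le_right _ _).trans
      (div_le_div_of_nonneg_right (min_le_left ρ₁ ρ₂) (by norm_num : (0 : ℝ) ≤ 3)))
    linarith
  have hδρ₂ : 2 * δ < ρ₂ := by
    have := hδ.2.trans ((min_le_right _ _).trans
      (div_le_div_of_nonneg_right (min_le_right ρ₁ ρ₂) (by norm_num : (0 : ℝ) ≤ 3)))
    linarith
  obtain ⟨hsm, -, hb, -, hz, hg1, hg0, hg⟩ := hf δ hδ0
  have hBΩ : Metric.ball p (2 * δ) ⊆ Ω := (Metric.ball_subset_ball hδρ₂.le).trans hρΩ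
  have hu0 := hLs (2 * δ) (by positivity) hδρ₂
  rw [(hG.smooth_mul hΩ hsm).h1GammaSq_eq hΩ]
  -- D bounds γ |∇f|²: the gradient vanishes on B(p,δ), and at distance at least δ the weight is at
  -- most 1 + (r₀/δ)^α.
  set D : ℝ := (1 + (r₀ / δ) ^ α) * (C / δ) ^ 2 with hD
  have hD0 : 0 ≤ D := by positivity
  have k1 : ∫⁻ x in Ω, ‖f δ x * u x‖ₑ ^ 2 ≤ ∫⁻ x in Metric.ball p (2 * δ), ‖u x‖ₑ ^ 2 := by
    calc ∫⁻ x in Ω, ‖f δ x * u x‖ₑ ^ 2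
        ≤ ∫⁻ x in Ω, (Metric.ball p (2 * δ)).indicator (fun x => ‖u x‖ₑ ^ 2) x := by
          refine lintegral_mono fun x => ?_
          by_cases hx : x ∈ Metric.ball p (2 * δ)
          · rw [indicator_of_mem hx, enorm_mul, mul_pow]
            refine mul_le_of_le_one_left' (pow_le_one' ?_ 2)
            rw [← ofReal_norm, ← ENNReal.ofReal_one]
            exact ENNReal.ofReal_le_ofReal (hb x)
          · simp [hz x hx]
      _ = _ := by
          rw [lintegral_indicator measurableSet_ball,
            Measure.restrict_restrict measurableSet_ball, inter_eq_left.2 hBΩ]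
  have k2 : ∫⁻ x in Ω, ENNReal.ofReal (γ x) * ‖f δ x • G x + u x • gradient (f δ) x‖ₑ ^ 2 ≤
      2 * E (2 * δ) + 2 * ENNReal.ofReal D * ∫⁻ x in Metric.ball p (2 * δ), ‖u x‖ₑ ^ 2 := by
    have hum : AEMeasurable (fun x => ‖u x‖ₑ ^ 2) (volume.restrict (Metric.ball p (2 * δ))) :=
      (hu2.1.mono_measure (Measure.restrict_mono hBΩ le_rfl)).enorm.pow_const 2
    calc ∫⁻ x in Ω, ENNReal.ofReal (γ x) * ‖f δ x • G x + u x • gradient (f δ) x‖ₑ ^ 2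
        ≤ ∫⁻ x in Ω, (Metric.ball p (2 * δ)).indicator (fun x =>
            2 * (ENNReal.ofReal (γ x) * ‖G x‖ₑ ^ 2) +
              2 * ENNReal.ofReal D * ‖u x‖ₑ ^ 2) x := by
          refine lintegral_mono_ae (ae_restrict_of_ae ?_)
          filter_upwards [Measure.ae_ne volume p] with x hxp
          by_cases hx : x ∈ Metric.ball p (2 * δ)
          · rw [indicator_of_mem hx]
            have j1 : ENNReal.ofReal (γ x) * ‖gradient (f δ) x‖ₑ ^ 2 ≤ ENNReal.ofReal D := by
              by_cases hx1 : x ∈ Metric.ball p δ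
              · simp [hg1 x hx1]
              · have hdx : δ ≤ dist x p := by simpa using hx1
                rw [hγp x (Metric.ball_subset_ball hδρ₁.le hx) hxp, ← ofReal_norm,
                  ← ENNReal.ofReal_pow (norm_nonneg _), ← ENNReal.ofReal_mul (by positivity)]
                refine ENNReal.ofReal_le_ofReal ?_
                rw [hD]
                gcongr
                exact hg x
            calc ENNReal.ofReal (γ x) * ‖f δ x • G x + u x • gradient (f δ) x‖ₑ ^ 2
                ≤ ENNReal.ofReal (γ x) * (2 * (1 * ‖G x‖ₑ) ^ 2 +
                    2 * (‖u x‖ₑ * ‖gradient (f δ) x‖ₑ) ^ 2) := by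
                  gcongr
                  refine (enorm_add_sq_le _ _).trans ?_
                  rw [enorm_smul, enorm_smul]
                  gcongr
                  rw [← ofReal_norm, ← ENNReal.ofReal_one]
                  exact ENNReal.ofReal_le_ofReal (hb x)
              _ = 2 * (ENNReal.ofReal (γ x) * ‖G x‖ₑ ^ 2) +
                    2 * (ENNReal.ofReal (γ x) * ‖gradient (f δ) x‖ₑ ^ 2) * ‖u x‖ₑ ^ 2 := by
                  ring
              _ ≤ _ := by gcongr
          · simp [hz x hx, hg0 x hx]
      _ = _ := by
          rw [lintegral_indicator measurableSet_ball,
            Measure.restrict_restrict measurableSet_ball, inter_eq_left.2 hBΩ,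
            lintegral_add_right' _ (hum.const_mul _), lintegral_const_mul' 2 _ (by simp),
            lintegral_const_mul' (2 * ENNReal.ofReal D) _ (by finiteness)]
  -- The decisive cancellation: D grows like δ^(-2-α), exactly the power offered by the Hardy-type
  -- bound.
  have hDs : D * (2 * δ) ^ (2 + α) ≤ (1 + r₀ ^ α) * C ^ 2 * 2 ^ (2 + α) := by
    have e1 : (2 * δ) ^ (2 + α) = 2 ^ (2 + α) * (δ ^ 2 * δ ^ α) := by
      rw [Real.mul_rpow (by norm_num) hδ0.le, Real.rpow_add hδ0]
      norm_cast
    have e2 : D * (2 * δ) ^ (2 + α) = (δ ^ α + r₀ ^ α) * C ^ 2 * 2 ^ (2 + α) := by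
      rw [e1, hD, Real.div_rpow hr₀.le hδ0.le]
      have : δ ^ α ≠ 0 := (Real.rpow_pos_of_pos hδ0 α).ne'
      field_simp
    rw [e2]
    gcongr
    exact Real.rpow_le_one hδ0.le hδ1 hα0
  have hs1 : (2 * δ) ^ (2 + α) ≤ 2 ^ (2 + α) :=
    Real.rpow_le_rpow (by positivity) (by linarith) (by linarith)
  calc (∫⁻ x in Ω, ‖f δ x * u x‖ₑ ^ 2) +
        ∫⁻ x in Ω, ENNReal.ofReal (γ x) * ‖f δ x • G x + u x • gradient (f δ) x‖ₑ ^ 2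
      ≤ ENNReal.ofReal (C₂ * (2 * δ) ^ (2 + α)) * E (2 * δ) + (2 * E (2 * δ) +
          2 * ENNReal.ofReal D * (ENNReal.ofReal (C₂ * (2 * δ) ^ (2 + α)) * E (2 * δ))) := by
        refine add_le_add (k1.trans hu0) (k2.trans ?_)
        gcongr
    _ = ENNReal.ofReal (C₂ * (2 * δ) ^ (2 + α) +
          (2 + 2 * D * (C₂ * (2 * δ) ^ (2 + α)))) * E (2 * δ) := by
        have e2 : (2 : ℝ≥0∞) = ENNReal.ofReal 2 := by simp
        rw [ENNReal.ofReal_add (by positivity) (by positivity),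
          ENNReal.ofReal_add (by positivity) (by positivity), e2,
          ← ENNReal.ofReal_mul (by positivity), ENNReal.ofReal_mul (p := 2 * D) (by positivity)]
        ring
    _ ≤ ENNReal.ofReal Q * E (2 * δ) := by
        gcongr
        rw [hQ]
        have e3 : 2 * D * (C₂ * (2 * δ) ^ (2 + α)) = 2 * C₂ * (D * (2 * δ) ^ (2 + α)) := by ring
        have e4 : 2 * ((1 + r₀ ^ α) * C ^ 2) * (C₂ * 2 ^ (2 + α)) =
          2 * C₂ * ((1 + r₀ ^ α) * C ^ 2 * 2 ^ (2 + α)) := by ring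
        rw [e3, e4]
        gcongr

/-- Membership in H¹ is carried through the induction because adding energies requires weak
gradients of both summands. -/
theorem tendsto_h1GammaSq_sum {d : ℕ} {Ω : Set (RSpace d)} (hΩ : IsOpen Ω) {γ : RSpace d → ℝ}
    (hγm : AEMeasurable γ (volume.restrict Ω)) {ι X : Type*} {l : Filter X}
    (g : ι → X → RSpace d → ℝ) (S : Finset ι)
    (hmem : ∀ i ∈ S, ∀ᶠ δ in l, g i δ ∈ H1 Ω)
    (h : ∀ i ∈ S, Tendsto (fun δ => h1GammaSq Ω γ (g i δ)) l (𝓝 0)) :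
    (∀ᶠ δ in l, (fun x => ∑ i ∈ S, g i δ x) ∈ H1 Ω) ∧
      Tendsto (fun δ => h1GammaSq Ω γ (fun x => ∑ i ∈ S, g i δ x)) l (𝓝 0) := by
  classical
  induction S using Finset.induction_on with
  | empty =>
    refine ⟨Eventually.of_forall fun δ => by simpa using! H1.zero_mem, ?_⟩
    have h0 : h1GammaSq Ω γ (fun _ => 0) = 0 := by
      refine (IsWeakGradient.zero.h1GammaSq_eq hΩ).trans ?_
      simp
    simp only [Finset.sum_empty, h0]
    exact tendsto_const_nhds
  | insert i S hi ih =>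
    obtain ⟨ih1, ih2⟩ := ih (fun j hj => hmem j (Finset.mem_insert_of_mem hj))
      (fun j hj => h j (Finset.mem_insert_of_mem hj))
    have hi1 := hmem i (Finset.mem_insert_self i S)
    have hi2 := h i (Finset.mem_insert_self i S)
    simp only [Finset.sum_insert hi]
    refine ⟨?_, ?_⟩
    · filter_upwards [ih1, hi1] with δ h1 h2 using H1.add_mem h2 h1
    · have hlim : Tendsto (fun δ => 2 * h1GammaSq Ω γ (g i δ) +
          2 * h1GammaSq Ω γ (fun x => ∑ j ∈ S, g j δ x)) l (𝓝 0) := by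
        simpa using (ENNReal.Tendsto.const_mul (a := 2) hi2 (Or.inr (by simp))).add
          (ENNReal.Tendsto.const_mul (a := 2) ih2 (Or.inr (by simp)))
      refine tendsto_of_tendsto_of_tendsto_of_le_of_le' tendsto_const_nhds hlim
        (Eventually.of_forall fun _ => zero_le) ?_
      filter_upwards [ih1, hi1] with δ h1 h2
      obtain ⟨-, G, hG, -⟩ := h1
      obtain ⟨-, H, hH, -⟩ := h2
      exact hH.h1GammaSq_add_le hΩ hγm hG

/-! ### Continuity of the trace and the characterization of its kernel -/

/-- Integrate |L|² ≤ 2|u|² + 2|u-L|² over a fixed ball: the L² norm controls the first term and the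
trace estimate the second. -/
theorem exists_trace_of_mem_H1Gamma {d : ℕ} (hd : 1 ≤ d) {Ω Γ : Set (RSpace d)} (hΩ : IsOpen Ω)
    (hlip : HasLipschitzBoundary Ω) (hΓΩ : Γ ⊆ Ω) {R r₀ α : ℝ} (hR : IsMinSeparation Γ R)
    (hr₀ : 0 < r₀) (hα0 : 0 ≤ α) (hα : (d : ℝ) - 2 < α) {γ : RSpace d → ℝ}
    (hγ : IsAdmissibleWeight Ω Γ r₀ α R γ) {p : RSpace d} (hp : p ∈ Γ) :
    ∃ C : ℝ≥0∞, C ≠ ⊤ ∧ ∀ u ∈ H1Gamma Ω γ,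
      ∃ L, Tendsto (fun s => ⨍ y in Metric.ball p s, u y) (𝓝[>] 0) (𝓝 L) ∧
        ‖L‖ₑ ^ 2 ≤ C * h1GammaSq Ω γ u := by
  obtain ⟨ρ, hρ, hρΩ, C, hC, htr⟩ := exists_trace hd hΩ hlip hΓΩ hR hr₀ hα0 hα hγ hp
  set s : ℝ := ρ / 2 with hs
  have hs0 : 0 < s := by positivity
  have hsρ : s < ρ := half_lt_self hρ
  set V : ℝ≥0∞ := volume (Metric.ball p s) with hV
  have hV0 : V ≠ 0 := (Metric.measure_ball_pos volume p hs0).ne'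
  have hVt : V ≠ ⊤ := measure_ball_lt_top.ne
  have hBΩ : Metric.ball p s ⊆ Ω := (Metric.ball_subset_ball hsρ.le).trans hρΩ
  refine ⟨(2 + 2 * ENNReal.ofReal (C * s ^ (2 + α))) / V,
    ENNReal.div_ne_top (by finiteness) hV0, ?_⟩
  rintro u ⟨⟨hu2, G, hG, hG2⟩, hfin⟩
  have hfin' : h1GammaSq Ω γ u < ⊤ := by simpa using h1GammaNorm_lt_iff.1 hfin
  have heq := hG.h1GammaSq_eq (γ := γ) hΩ
  have hE : ∫⁻ x in Ω, ENNReal.ofReal (γ x) * ‖G x‖ₑ ^ 2 ≤ h1GammaSq Ω γ u := by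
    rw [heq]; exact le_add_self
  have hU : ∫⁻ x in Ω, ‖u x‖ₑ ^ 2 ≤ h1GammaSq Ω γ u := by
    rw [heq]; exact le_self_add
  obtain ⟨L, hL, hLs⟩ := htr u G hG hu2 hG2 (hE.trans_lt hfin')
  refine ⟨L, hL, ?_⟩
  have hum : AEMeasurable (fun x => ‖u x‖ₑ ^ 2) (volume.restrict (Metric.ball p s)) :=
    (hu2.1.mono_measure (Measure.restrict_mono hBΩ le_rfl)).enorm.pow_const 2
  rw [mul_comm, ← mul_div_assoc, ENNReal.le_div_iff_mul_le (Or.inl hV0) (Or.inl hVt)]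
  calc ‖L‖ₑ ^ 2 * V = ∫⁻ _ in Metric.ball p s, ‖L‖ₑ ^ 2 := by rw [setLIntegral_const]
    _ ≤ ∫⁻ y in Metric.ball p s, (2 * ‖u y‖ₑ ^ 2 + 2 * ‖u y - L‖ₑ ^ 2) := by
        refine lintegral_mono fun y => ?_
        have h := enorm_add_sq_le (u y) (-(u y - L))
        rw [enorm_neg] at h
        simpa using h
    _ = 2 * (∫⁻ y in Metric.ball p s, ‖u y‖ₑ ^ 2) +
          2 * ∫⁻ y in Metric.ball p s, ‖u y - L‖ₑ ^ 2 := by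
        rw [lintegral_add_left' (hum.const_mul 2), lintegral_const_mul' _ _ (by simp),
          lintegral_const_mul' _ _ (by simp)]
    _ ≤ 2 * h1GammaSq Ω γ u +
          2 * (ENNReal.ofReal (C * s ^ (2 + α)) * h1GammaSq Ω γ u) := by
        gcongr
        · exact (lintegral_mono_set hBΩ).trans hU
        · refine (hLs s hs0 hsρ).trans ?_
          gcongr
          exact (lintegral_mono_set hBΩ).trans hE
    _ = _ := by ring

/-- A test function vanishes near p, so u - φ has the same limit as u, while its norm, and with it
the limit, can be made arbitrarily small. -/
theorem trace_eq_zero_of_mem_H1GammaZero {d : ℕ} (hd : 1 ≤ d) {Ω Γ : Set (RSpace d)}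
    (hΩ : IsOpen Ω)
    (hlip : HasLipschitzBoundary Ω) (hΓΩ : Γ ⊆ Ω) {R r₀ α : ℝ} (hR : IsMinSeparation Γ R)
    (hr₀ : 0 < r₀) (hα0 : 0 ≤ α) (hα : (d : ℝ) - 2 < α) {γ : RSpace d → ℝ}
    (hγ : IsAdmissibleWeight Ω Γ r₀ α R γ) {p : RSpace d} (hp : p ∈ Γ) {u : RSpace d → ℝ}
    (hu : u ∈ H1GammaZero Ω Γ γ) :
    Tendsto (fun s => ⨍ y in Metric.ball p s, u y) (𝓝[>] 0) (𝓝 0) := by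
  obtain ⟨C, hC, htr⟩ :=
    exists_trace_of_mem_H1Gamma hd hΩ hlip hΓΩ hR hr₀ hα0 hα hγ hp
  obtain ⟨L, hL, -⟩ := htr u hu.1
  have hzero : ‖L‖ₑ ^ 2 ≤ 0 := by
    refine ENNReal.le_of_forall_le_add_mul hC fun ε hε => ?_
    -- The cap at 1 makes u - φ of finite norm and the square of the tolerance at most ε.
    have hε1 : 0 < min ε 1 := lt_min hε one_pos
    obtain ⟨φ, hφ, hlt⟩ := hu.2 (min ε 1) hε1
    have hw : (fun x => u x - φ x) ∈ H1Gamma Ω γ :=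
      ⟨H1.sub_mem hu.1.1 (H1.of_contDiff hφ.1 hφ.2.1),
        hlt.trans_le ((min_le_right _ _).trans le_top)⟩
    obtain ⟨L', hL', hle⟩ := htr _ hw
    have hpφ : p ∈ (tsupport φ)ᶜ := fun h => disjoint_left.1 hφ.2.2 h hp
    obtain ⟨r, hr, hrφ⟩ := Metric.isOpen_iff.1 (isClosed_tsupport φ).isOpen_compl p hpφ
    have hLL : L' = L := by
      refine tendsto_nhds_unique hL' (hL.congr' ?_)
      filter_upwards [Ioc_mem_nhdsGT hr] with s hs
      refine setAverage_congr_fun measurableSet_ball (Eventually.of_forall fun y hy => ?_)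
      rw [image_eq_zero_of_notMem_tsupport (hrφ (Metric.ball_subset_ball hs.2 hy)), sub_zero]
    rw [← hLL, zero_add, mul_comm]
    refine hle.trans ?_
    gcongr
    refine (h1GammaNorm_lt_iff.1 hlt).le.trans ?_
    calc (min ε 1) ^ 2 = min ε 1 * min ε 1 := sq _
      _ ≤ ε * 1 := by gcongr <;> simp
      _ = ε := mul_one _
  have hL0 : L = 0 := by simpa using hzero
  rwa [hL0] at hL

/-- Split u into the sum of its cutoffs at the points of Γ, whose energy tends to 0, and a remainder
vanishing near Γ, which is a limit of test functions. -/
theorem mem_H1GammaZero_of_trace_eq_zero {d : ℕ} (hd : 1 ≤ d) {Ω Γ : Set (RSpace d)}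
    (hΩ : IsOpen Ω) (hΩb : Bornology.IsBounded Ω)
    (hlip : HasLipschitzBoundary Ω) (hΓ : Γ.Finite) (hΓΩ : Γ ⊆ Ω) {R r₀ α : ℝ}
    (hR : IsMinSeparation Γ R)
    (hr₀ : 0 < r₀) (hα0 : 0 ≤ α) (hα : (d : ℝ) - 2 < α) {γ : RSpace d → ℝ}
    (hγ : IsAdmissibleWeight Ω Γ r₀ α R γ) {u : RSpace d → ℝ} (hu : u ∈ H1Gamma Ω γ)
    (hTr : ∀ p ∈ Γ, Tendsto (fun s => ⨍ y in Metric.ball p s, u y) (𝓝[>] 0) (𝓝 0)) :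
    u ∈ H1GammaZero Ω Γ γ := by
  refine ⟨hu, fun ε hε => ?_⟩
  have hγm := hγ.aemeasurable hd hΩ hΓ
  choose C hC f hf using fun p : RSpace d => exists_cutoff_family p
  obtain ⟨hmem, hlim⟩ := tendsto_h1GammaSq_sum hΩ hγm (l := 𝓝[>] (0 : ℝ))
    (fun p δ x => f p δ x * u x) hΓ.toFinset
    (fun p hp => by
      filter_upwards [self_mem_nhdsWithin] with δ hδ
      exact H1.smooth_mul_mem hΩ hu.1 (hf p δ hδ).1 (hf p δ hδ).2.1)
    (fun p hp => tendsto_h1GammaSq_cutoff hd hΩ hlip hΓΩ hR hr₀ hα0 hα hγ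
      (hΓ.mem_toFinset.1 hp) hu (hTr p (hΓ.mem_toFinset.1 hp)) (hf p))
  -- Two errors of size m combine to 4m; dividing by 5 gives strict inequality, and the cap at 1
  -- keeps m finite even for ε = ⊤.
  have hε4 : 0 < ε ^ 2 / 5 := ENNReal.div_pos (pow_ne_zero 2 hε.ne') (by simp)
  have hR4 : 0 < R / 4 := by linarith [hR.1]
  obtain ⟨δ, ⟨hvH, hvε⟩, hδ⟩ := ((hmem.and (hlim.eventually (gt_mem_nhds
    (lt_min hε4 one_pos)))).and (Ioc_mem_nhdsGT hR4)).exists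
  have hδ0 : 0 < δ := hδ.1
  have hwH := H1.sub_mem hu.1 hvH
  have hw0 : ∀ x ∈ ⋃ p ∈ Γ, Metric.ball p δ,
      u x - ∑ p ∈ hΓ.toFinset, f p δ x * u x = 0 := by
    intro x hx
    obtain ⟨p, hp, hxp⟩ := mem_iUnion₂.1 hx
    -- On B(p,δ) only the cutoff at p survives: a point also within 2δ of q would force |p - q| < 3δ
    -- ≤ 3R/4.
    rw [Finset.sum_eq_single p]
    · rw [(hf p δ hδ0).2.2.2.1 x hxp]; ring
    · intro q hq hqp
      have hq' := hΓ.mem_toFinset.1 hq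
      have hdist : R ≤ dist q p :=
        (hR.2 ⟨q, hq', p, hp, hqp⟩).2 ⟨q, hq', p, hp, hqp, rfl⟩
      rw [(hf q δ hδ0).2.2.2.2.1 x ?_, zero_mul]
      intro hxq
      rw [Metric.mem_ball] at hxp hxq
      linarith [dist_triangle_left q p x, hδ.2]
    · exact fun h => absurd (hΓ.mem_toFinset.2 hp) h
  have hlimit := isTestLimit_of_eqOn_zero hΩ hΩb hlip hΓ.isClosed hγ.smooth.continuousOn hγm
    (U := ⋃ p ∈ Γ, Metric.ball p δ) (isOpen_biUnion fun p _ => Metric.isOpen_ball)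
    (fun p hp => mem_iUnion₂.2 ⟨p, hp, Metric.mem_ball_self hδ0⟩) hwH hw0
  obtain ⟨φ, hφ, hφε⟩ := hlimit (min (ε ^ 2 / 5) 1) (lt_min hε4 one_pos)
  refine ⟨φ, hφ, h1GammaNorm_lt_iff.2 ?_⟩
  obtain ⟨-, G, hG, -⟩ := hvH
  obtain ⟨-, H, hH, -⟩ := hwH
  have hadd := hG.h1GammaSq_add_le hΩ hγm (hH.sub (IsWeakGradient.of_contDiff hφ.1))
  have e : (fun x => u x - φ x) = fun x => (∑ p ∈ hΓ.toFinset, f p δ x * u x) +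
      (u x - (∑ p ∈ hΓ.toFinset, f p δ x * u x) - φ x) := by
    ext x; ring
  rw [e]
  refine hadd.trans_lt ?_
  set m : ℝ≥0∞ := min (ε ^ 2 / 5) 1 with hm
  have hmt : m ≠ ⊤ := ((min_le_right _ _).trans_lt ENNReal.one_lt_top).ne
  have hm0 : m ≠ 0 := (lt_min hε4 one_pos).ne'
  calc _ ≤ 2 * m + 2 * m := by gcongr
    _ = m * 4 := by ring
    _ < m * 5 := (ENNReal.mul_lt_mul_iff_right hm0 hmt).2 (by norm_num)
    _ ≤ ε ^ 2 / 5 * 5 := by gcongr; exact min_le_left _ _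
    _ = ε ^ 2 := ENNReal.div_mul_cancel (by simp) (by simp)

theorem mainTheorem11 (d : ℕ) (hd : 1 ≤ d)
    (Ω : Set (RSpace d)) (hΩ_open : IsOpen Ω) (hΩ_bdd : Bornology.IsBounded Ω)
    (hΩ_lip : HasLipschitzBoundary Ω)
    (Γ : Set (RSpace d)) (hΓ_fin : Γ.Finite) (hΓ_ne : Γ.Nonempty) (hΓΩ : Γ ⊆ Ω)
    (R : ℝ) (hR : IsMinSeparation Γ R)
    (r₀ : ℝ) (hr₀ : 0 < r₀) (α : ℝ) (hα_nonneg : 0 ≤ α) (hα : (d : ℝ) - 2 < α)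
    (γ : RSpace d → ℝ) (hγ : IsAdmissibleWeight Ω Γ r₀ α R γ) :
    -- the limit defining the trace exists, so that the trace operator is well defined
    (∀ u ∈ H1Gamma Ω γ, ∀ x ∈ Γ,
      Tendsto (fun ε : ℝ => ⨍ y in Metric.ball x ε, u y) (𝓝[>] (0 : ℝ)) (𝓝 (traceAt u x))) ∧
    -- characterization of the trace zero functions
    (∀ u : RSpace d → ℝ,
      u ∈ H1GammaZero Ω Γ γ ↔ u ∈ H1Gamma Ω γ ∧ ∀ x ∈ Γ, traceAt u x = 0) := by
  have hex : ∀ u ∈ H1Gamma Ω γ, ∀ x ∈ Γ,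
      Tendsto (fun ε : ℝ => ⨍ y in Metric.ball x ε, u y) (𝓝[>] (0 : ℝ)) (𝓝 (traceAt u x)) := by
    intro u hu x hx
    obtain ⟨C, -, htr⟩ :=
      exists_trace_of_mem_H1Gamma hd hΩ_open hΩ_lip hΓΩ hR hr₀ hα_nonneg hα hγ hx
    obtain ⟨L, hL, -⟩ := htr u hu
    rwa [traceAt, hL.limUnder_eq]
  refine ⟨hex, fun u => ⟨fun hu => ⟨hu.1, fun x hx => ?_⟩, fun hu => ?_⟩⟩
  · exact (trace_eq_zero_of_mem_H1GammaZero hd hΩ_open hΩ_lip hΓΩ hR hr₀ hα_nonneg hα hγ hx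
      hu).limUnder_eq
  · refine mem_H1GammaZero_of_trace_eq_zero hd hΩ_open hΩ_bdd hΩ_lip hΓ_fin hΓΩ hR hr₀ hα_nonneg
      hα hγ hu.1 fun p hp => ?_
    have h := hex u hu.1 p hp
    rwa [hu.2 p hp] at h
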